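/- Let $\mathbb O$ be the octonions with imaginary units $e_1,\dots,e_7$, multiplied so that $e_ie_j=e_k$ (cyclically in $i,j,k$) for $(i,j,k)=(1,5,2),(1,6,3),(1,7,4),(2,7,3),(2,4,6),(3,5,4),(5,6,7)$, distinct units anticommute and $e_i^2=-1$. Identify $\mathbb C^7=\operatorname{Im}(\mathbb O)\otimes\mathbb C$, with conjugation $v\mapsto\bar v$, the complex bilinear form $\langle x,y\rangle=\sum_i x_iy_i$, orthogonal complements $\perp$ taken with respect to it, and $x\cdot y\in\mathbb C^7$ the imaginary part of the octonionic product. Let $\mathbb G_2\subset SO(7,\mathbb C)$ be the automorphism group of $\mathbb O\otimes\mathbb C$ acting on $\mathbb C^7$. A subspace is isotropic if $\langle\cdot,\cdot\rangle$ vanishes on it; a complex coassociative plane is an isotropic $2$-plane $\mathcal C\subset\mathbb C^7$ with $\mathcal C\cdot\mathcal C=0$. Let $\mathcal L_-^\tau(\mathbb G_2,\mathbb C^7)$ be the group of functions $g$ that are holomorphic with values in $\mathbb G_2$ on an open dense subset of $\mathbb{CP}^1$, meromorphic on $\mathbb{CP}^1$ as $\operatorname{End}(\mathbb C^7)$-valued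 functions, satisfy $\overline{g(\bar\lambda)}=g(\lambda)$, and are holomorphic at $\infty$ with $g(\infty)=\mathrm{Id}$; functions that agree on an open dense set are identified. For $\alpha\in\mathbb C\setminus\mathbb R$ and an isotropic subspace $W\subset\mathbb C^7$ put \[ p_{\alpha,W}(\lambda)=\frac{\lambda-\bar\alpha}{\lambda-\alpha}\,\pi_{\overline W}+\pi_{(W\oplus\overline W)^\perp}+\frac{\lambda-\alpha}{\lambda-\bar\alpha}\,\pi_W , \] where $\pi_U$ is the Hermitian orthogonal projection onto $U$. Fix $\alpha\in\mathbb C\setminus\mathbb R$. For isotropic lines $L,K\subset\mathbb C^7$ consider the condition \[ (*)\qquad K\subset\overline L^{\perp}\quad\text{and}\quad \mathcal C=L\oplus\pi_{(L\oplus\overline L)^\perp}K\ \text{ is a complex coassociative plane.} \] (1) If $L,K$ are isotropic lines with $K\neq\overline L$, then $(*)$ holds if and only if $p_{\alpha,L}\,p_{\alpha,K}\in\mathcal L_-^\tau(\mathbb G_2,\mathbb C^7)$. (2) If $L,K$ are isotropic lines satisfying $(*)$, then $p_{\alpha,L}\,p_{\alpha,K}$ has simple poles at $\alpha$ and $\bar\alpha$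 and no other poles. (3) Let $g\in\mathcal L_-^\tau(\mathbb G_2,\mathbb C^7)$ have simple poles at $\alpha$ and $\bar\alpha$ and no other poles. Then $g=p_{\alpha,L}\,p_{\alpha,K}$ for some isotropic lines $L,K$ satisfying $(*)$. Moreover, for every factorization $g=p_{\alpha,L}\,p_{\alpha,K}$ with isotropic lines $L,K$: if $K\subset(L\oplus\overline L)^\perp$, then $L\oplus\pi_{(L\oplus\overline L)^\perp}K=L\oplus K$ is complex coassociative and $g=p_{\alpha,L\oplus K}$; and if $K\not\subset(L\oplus\overline L)^\perp$, then there is an isotropic line $R$ such that $\mathcal C_1=L\oplus R$ and $\mathcal C_2=\overline R\oplus K$ are complex coassociative and $g=p_{\alpha,\mathcal C_1}\,p_{\alpha,\mathcal C_2}$. -/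

import Mathlib

open Filter Topology

noncomputable section

namespace G2Loop

/-- `ℂ⁷ = Im 𝕆 ⊗ ℂ` with its standard Hermitian inner product. The index `i : Fin 7` stands for
the imaginary unit `e_{i+1}`. -/
abbrev V : Type := EuclideanSpace ℂ (Fin 7)

/-- The complex bilinear extension of the standard inner product of `ℝ⁷`. -/
def dot (x y : V) : ℂ := ∑ i, x i * y i

/-- The imaginary part of the product of two imaginary (complexified) octonions, for the
multiplication table of `e₁, …, e₇` in which `e_i e_j = e_k`, cyclically in `(i, j, k)`, for
`(1,5,2), (1,6,3), (1,7,4), (2,7,3), (2,4,6), (3,5,4), (5,6,7)`. -/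
def imMul (x y : V) : V :=
  !₂[(x 4 * y 1 - x 1 * y 4) + (x 5 * y 2 - x 2 * y 5) + (x 6 * y 3 - x 3 * y 6),
     (x 0 * y 4 - x 4 * y 0) + (x 6 * y 2 - x 2 * y 6) + (x 3 * y 5 - x 5 * y 3),
     (x 0 * y 5 - x 5 * y 0) + (x 1 * y 6 - x 6 * y 1) + (x 4 * y 3 - x 3 * y 4),
     (x 0 * y 6 - x 6 * y 0) + (x 5 * y 1 - x 1 * y 5) + (x 2 * y 4 - x 4 * y 2),
     (x 1 * y 0 - x 0 * y 1) + (x 3 * y 2 - x 2 * y 3) + (x 5 * y 6 - x 6 * y 5),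
     (x 2 * y 0 - x 0 * y 2) + (x 1 * y 3 - x 3 * y 1) + (x 6 * y 4 - x 4 * y 6),
     (x 3 * y 0 - x 0 * y 3) + (x 2 * y 1 - x 1 * y 2) + (x 4 * y 5 - x 5 * y 4)]

/-- The product of the complexified octonions `𝕆 ⊗ ℂ = ℂ·1 ⊕ Im 𝕆 ⊗ ℂ`. -/
def octMul (p q : ℂ × V) : ℂ × V :=
  (p.1 * q.1 - dot p.2 q.2, p.1 • q.2 + q.1 • p.2 + imMul p.2 q.2)

/-- The operator `A` of `ℂ⁷` belongs to the complex group `𝔾₂`: it is the restriction to the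
imaginary part of an automorphism of the complex algebra `𝕆 ⊗ ℂ`. -/
def InG2 (A : V →L[ℂ] V) : Prop :=
  ∃ φ : (ℂ × V) ≃ₗ[ℂ] (ℂ × V),
    (∀ p q, φ (octMul p q) = octMul (φ p) (φ q)) ∧ ∀ v, φ (0, v) = (0, A v)

/-- Complex conjugation on `ℂ⁷`. -/
def conjV (x : V) : V := WithLp.toLp 2 fun i => (starRingEnd ℂ) (x i)

/-- The complex conjugate `W̄` of a subspace `W` of `ℂ⁷`. -/
def conjSub (W : Submodule ℂ V) : Submodule ℂ V where
  carrier := {x | conjV x ∈ W}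
  zero_mem' := by
    have h : conjV 0 = 0 := by ext i; simp [conjV]
    simp [h]
  add_mem' := by
    intro a b ha hb
    have h : conjV (a + b) = conjV a + conjV b := by ext i; simp [conjV]
    simpa [h] using W.add_mem ha hb
  smul_mem' := by
    intro c a ha
    have h : conjV (c • a) = (starRingEnd ℂ c) • conjV a := by ext i; simp [conjV]
    simpa [h] using W.smul_mem (starRingEnd ℂ c) ha

/-- The orthogonal `W^⊥` with respect to the complex bilinear form `dot`. -/
def perp (W : Submodule ℂ V) : Submodule ℂ V where
  carrier := {x | ∀ y ∈ W, dot x y = 0}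
  zero_mem' := by intro y _; simp [dot]
  add_mem' := by
    intro a b ha hb y hy
    have h : dot (a + b) y = dot a y + dot b y := by
      simp [dot, add_mul, Finset.sum_add_distrib]
    rw [h, ha y hy, hb y hy, add_zero]
  smul_mem' := by
    intro c a ha y hy
    have h : dot (c • a) y = c * dot a y := by simp [dot, Finset.mul_sum, mul_assoc]
    rw [h, ha y hy, mul_zero]

/-- `W` is isotropic for the complex bilinear form. -/
def IsIsotropic (W : Submodule ℂ V) : Prop := ∀ x ∈ W, ∀ y ∈ W, dot x y = 0

/-- Isotropic complex lines in `ℂ⁷`. -/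
def IsIsotropicLine (L : Submodule ℂ V) : Prop := Module.finrank ℂ L = 1 ∧ IsIsotropic L

/-- Complex coassociative planes: isotropic 2-planes `C` with `C · C = 0`. -/
def IsCoassociative (C : Submodule ℂ V) : Prop :=
  Module.finrank ℂ C = 2 ∧ IsIsotropic C ∧ ∀ x ∈ C, ∀ y ∈ C, imMul x y = 0

/-- The simple factor `p_{α,W}` attached to an isotropic subspace `W` (a line or a complex
coassociative plane):
`p_{α,W}(z) = (z-ᾱ)/(z-α) π_{W̄} + π_{(W⊕W̄)^⊥} + (z-α)/(z-ᾱ) π_W`, where the `π` are the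
Hermitian orthogonal projections. Its values at `α` and `ᾱ` are irrelevant. -/
def simpleFactor (α : ℂ) (W : Submodule ℂ V) (z : ℂ) : V →L[ℂ] V :=
  ((z - (starRingEnd ℂ) α) / (z - α)) • (conjSub W).starProjection
    + (perp (W ⊔ conjSub W)).starProjection
    + ((z - α) / (z - (starRingEnd ℂ) α)) • W.starProjection

/-- Two loops are identified when they agree on an open dense set. -/
def LoopEq (f g : ℂ → V →L[ℂ] V) : Prop :=
  ∃ U : Set ℂ, IsOpen U ∧ Dense U ∧ ∀ z ∈ U, f z = g z

/-- `g` represents an element of the rational loop group of `𝔾₂` on `ℂ⁷`: it is holomorphic with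
values in `𝔾₂` on an open dense set, and it is meromorphic on the Riemann sphere (at `∞` through
the coordinate `1/z`). -/
structure IsRationalG2Loop (g : ℂ → V →L[ℂ] V) : Prop where
  groupValued : ∃ U : Set ℂ, IsOpen U ∧ Dense U ∧ DifferentiableOn ℂ g U ∧ ∀ z ∈ U, InG2 (g z)
  meromorphic : ∀ z, MeromorphicAt g z
  meromorphic_infty : MeromorphicAt (fun w => g w⁻¹) 0

/-- `g` represents an element of the group `𝓛₋^τ(𝔾₂, ℂ⁷)` of rational loops that satisfy the
reality condition `τ(g(z̄)) = g(z)`, for `τ(A) = Ā`, and are holomorphic at `∞` with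
`g(∞) = Id`. -/
structure IsNegRealG2Loop (g : ℂ → V →L[ℂ] V) : Prop extends IsRationalG2Loop g where
  reality : ∃ U : Set ℂ, IsOpen U ∧ Dense U ∧
    ∀ z ∈ U, ∀ v, conjV (g ((starRingEnd ℂ) z) (conjV v)) = g z v
  negative : ∃ h : ℂ → V →L[ℂ] V, AnalyticAt ℂ h 0 ∧ h 0 = ContinuousLinearMap.id ℂ V ∧
    ∀ᶠ w in 𝓝[≠] (0 : ℂ), g w⁻¹ = h w

/-- `g` has simple poles at `α` and at `ᾱ`, and no other pole in `ℂ`. -/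
def OnlySimplePoles (g : ℂ → V →L[ℂ] V) (α : ℂ) : Prop :=
  meromorphicOrderAt g α = -1 ∧ meromorphicOrderAt g ((starRingEnd ℂ) α) = -1 ∧
    ∀ z, z ≠ α → z ≠ (starRingEnd ℂ) α → 0 ≤ meromorphicOrderAt g z

/-- `L + π_{(L⊕L̄)^⊥} K`. -/
def pairPlane (L K : Submodule ℂ V) : Submodule ℂ V :=
  L ⊔ K.map ((perp (L ⊔ conjSub L)).starProjection : V →ₗ[ℂ] V)

/-- The condition on a pair of lines: `K ⊂ L̄^⊥`, and `L ⊕ π_{(L⊕L̄)^⊥} K` is complex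
coassociative (in particular of dimension two). -/
def PairCondition (L K : Submodule ℂ V) : Prop :=
  K ≤ perp (conjSub L) ∧ IsCoassociative (pairPlane L K)

end G2Loop

end

/-!
In the coordinate `a = (z - α) / (z - ᾱ)`, a loop of the third part of the theorem has the form
`1 + (a - 1) P + (a⁻¹ - 1) P̄`, and the simple factor of an isotropic line `ℂ l` with
`⟨l, l̄⟩ = 1` is the boost that multiplies `l` by `a` and `l̄` by `a⁻¹`. The axis `w = l · l̄` has
`⟨w, w⟩ = -1`, so `x ↦ x · w` has eigenvalues `1`, `-1`, `0` with eigenspaces `E₊`, `E₋`, `ℂ w`,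
and the boost of `l` preserves them and is a similitude for the product `E₊ × E₊ → E₋`.

If the product of the boosts of `l` and `k` is a loop in `𝔾₂`, its derivative at `a = 1` is a
derivation of the product, which forces `l · l̄ + k · k̄ = 0`. Conversely the two boosts then have
the same pair of eigenspaces and inverse similitude factors, so that their product is an
automorphism. In both cases the condition reads `k ∈ E₋`, which is also what the condition on
the coassociative plane amounts to when `ℂ k ≠ ℂ l̄`.

For the factorization, the range of `P` is isotropic with zero product, hence of dimension at
most two, and splitting off a boost enlarges the kernel of `P`; a single boost is never in `𝔾₂`,
so there are exactly two. Finally `r = l · k̄` spans the line `R`, and the factors of `R` and `R̄`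
cancel.
-/

namespace G2Loop

section RationalFunctions

variable {E : Type*} [NormedAddCommGroup E]

lemma tendsto_cobounded_of_eventuallyEq_nhdsNE {f g : ℂ → E} {c : E} (hg : Continuous g)
    (hfg : ∀ x, f =ᶠ[𝓝[≠] x] g) (hf : Tendsto f (Bornology.cobounded ℂ) (𝓝 c)) :
    Tendsto g (Bornology.cobounded ℂ) (𝓝 c) := by
  refine (closed_nhds_basis c).tendsto_right_iff.2 fun C ⟨hCc, hC⟩ => ?_
  have hbasis := Metric.hasBasis_cobounded_compl_closedBall (0 : ℂ)
  obtain ⟨r, -, hr⟩ := hbasis.mem_iff.1 (hf.eventually hCc)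
  filter_upwards [hbasis.mem_of_mem trivial (i := r)] with x hx
  have hgx : Tendsto g (𝓝[≠] x) (𝓝 (g x)) := hg.continuousAt.continuousWithinAt
  refine hC.mem_of_tendsto hgx ?_
  filter_upwards [hfg x, nhdsWithin_le_nhds (Metric.isClosed_closedBall.isOpen_compl.mem_nhds hx)]
    with z hz hzr
  exact hz ▸ hr hzr

variable [NormedSpace ℂ E]

lemma exists_order_sub_inv_smul_nonneg {f : ℂ → E} {s : ℂ} (hf : MeromorphicAt f s)
    (hord : -1 ≤ meromorphicOrderAt f s) :
    ∃ A : E, 0 ≤ meromorphicOrderAt (fun z => f z - (z - s)⁻¹ • A) s := by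
  have hlin : MeromorphicAt (fun z : ℂ => z - s) s := by fun_prop
  have hmul : 0 ≤ meromorphicOrderAt ((fun z => z - s) • f) s := by
    rw [meromorphicOrderAt_smul hlin hf, meromorphicOrderAt_id_sub_const]
    simpa using add_le_add_right hord 1
  obtain ⟨F, hF, hfF⟩ := (hlin.smul hf).meromorphicOrderAt_nonneg_iff.mp hmul
  have hslope : AnalyticAt ℂ (dslope F s) s := by
    obtain ⟨p, hp⟩ := hF
    exact hp.has_fpower_series_dslope_fslope.analyticAt
  refine ⟨F s, ?_⟩
  rw [meromorphicOrderAt_congr (f₂ := dslope F s)]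
  · exact hslope.meromorphicOrderAt_nonneg
  filter_upwards [hfF, self_mem_nhdsWithin] with z hz hzs
  have hz0 : z - s ≠ 0 := sub_ne_zero.2 hzs
  rw [dslope_of_ne _ hzs, slope_def_module, ← hz, Pi.smul_apply', smul_sub, inv_smul_smul₀ hz0]

lemma min_order_zero_le_order_sub_inv_smul {f : ℂ → E} {s x : ℂ} (hf : MeromorphicAt f x)
    (hx : x ≠ s) (A : E) :
    min (meromorphicOrderAt f x) 0 ≤ meromorphicOrderAt (fun z => f z - (z - s)⁻¹ • A) x := by
  have hpolar : AnalyticAt ℂ (fun z => -((z - s)⁻¹ • A)) x :=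
    (((analyticAt_id.sub analyticAt_const).inv (sub_ne_zero.2 hx)).smul analyticAt_const).neg
  have hsub : (fun z => f z - (z - s)⁻¹ • A) = f + fun z => -((z - s)⁻¹ • A) := by
    ext z; simp [sub_eq_add_neg]
  rw [hsub]
  exact (min_le_min_left _ hpolar.meromorphicOrderAt_nonneg).trans
    (meromorphicOrderAt_add hf hpolar.meromorphicAt)

lemma tendsto_inv_sub_smul_cobounded (s : ℂ) (A : E) :
    Tendsto (fun z => (z - s)⁻¹ • A) (Bornology.cobounded ℂ) (𝓝 0) := by
  simpa using (tendsto_inv₀_cobounded.comp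
    (tendsto_sub_const_cobounded s)).smul_const A

theorem eventuallyEq_const_of_order_nonneg {f : ℂ → E} {c : E}
    (hf : ∀ x, MeromorphicAt f x) (hord : ∀ x, 0 ≤ meromorphicOrderAt f x)
    (hlim : Tendsto f (Bornology.cobounded ℂ) (𝓝 c)) (x : ℂ) :
    f =ᶠ[𝓝[≠] x] fun _ => c := by
  have hfU : MeromorphicOn f Set.univ := fun x _ => hf x
  set g := toMeromorphicNFOn f Set.univ
  have hfg (x : ℂ) : f =ᶠ[𝓝[≠] x] g := (hfU.toMeromorphicNFOn_eq_self_on_nhdsNE trivial).symm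
  have hg : Differentiable ℂ g := fun x => by
    refine ((meromorphicNFOn_toMeromorphicNFOn f Set.univ
      trivial).meromorphicOrderAt_nonneg_iff_analyticAt.1 ?_).differentiableAt
    rw [meromorphicOrderAt_toMeromorphicNFOn hfU trivial]
    exact hord x
  have hgc : Tendsto g (cocompact ℂ) (𝓝 c) := by
    rw [← Metric.cobounded_eq_cocompact]
    exact tendsto_cobounded_of_eventuallyEq_nhdsNE hg.continuous hfg hlim
  filter_upwards [hfg x] with z hz
  rw [hz, hg.apply_eq_of_tendsto_cocompact z hgc]

theorem exists_eventuallyEq_partialFractions {f : ℂ → E} {c : E} (S : Finset ℂ)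
    (hf : ∀ x, MeromorphicAt f x) (hpole : ∀ x ∈ S, -1 ≤ meromorphicOrderAt f x)
    (hord : ∀ x ∉ S, 0 ≤ meromorphicOrderAt f x)
    (hlim : Tendsto f (Bornology.cobounded ℂ) (𝓝 c)) :
    ∃ A : ℂ → E, ∀ x, f =ᶠ[𝓝[≠] x] fun z => c + ∑ s ∈ S, (z - s)⁻¹ • A s := by
  induction S using Finset.induction_on generalizing f with
  | empty =>
    exact ⟨0, by simpa using eventuallyEq_const_of_order_nonneg hf (by simpa using hord) hlim⟩
  | insert s S hs ih =>
    obtain ⟨B, hB⟩ := exists_order_sub_inv_smul_nonneg (hf s) (hpole s (S.mem_insert_self s))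
    obtain ⟨A, hA⟩ := ih (f := fun z => f z - (z - s)⁻¹ • B) (fun x => by fun_prop)
      (fun x hx => (le_min (hpole x (S.mem_insert_of_mem hx)) (by decide)).trans
        (min_order_zero_le_order_sub_inv_smul (hf x) (ne_of_mem_of_not_mem hx hs) B))
      (fun x hx => by
        rcases eq_or_ne x s with rfl | hxs
        · exact hB
        · exact (le_min (hord x (by simp [hx, hxs])) le_rfl).trans
            (min_order_zero_le_order_sub_inv_smul (hf x) hxs B))
      (by simpa using hlim.sub (tendsto_inv_sub_smul_cobounded s B))
    refine ⟨Function.update A s B, fun x => ?_⟩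
    filter_upwards [hA x] with z hz
    have hsum : ∑ t ∈ S, (z - t)⁻¹ • Function.update A s B t = ∑ t ∈ S, (z - t)⁻¹ • A t :=
      Finset.sum_congr rfl fun t ht => by
        rw [Function.update_of_ne (ne_of_mem_of_not_mem ht hs)]
    rw [Finset.sum_insert hs, Function.update_self, hsum, sub_eq_iff_eq_add'.1 hz]
    abel

end RationalFunctions

section DenseSets

lemma eventually_nhdsNE_mem_compl_pair (p q x : ℂ) : ∀ᶠ z in 𝓝[≠] x, z ∈ ({p, q}ᶜ : Set ℂ) :=
  nhdsNE_le_cofinite x (Set.toFinite {p, q}).compl_mem_cofinite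

lemma isOpen_dense_of_eventually_nhdsNE {p : ℂ → Prop} (h : ∀ x, ∀ᶠ z in 𝓝[≠] x, p z) :
    IsOpen {z | p z} ∧ Dense {z | p z} := by
  have hcodisc : {z | p z} ∈ codiscrete ℂ := by
    simp only [mem_codiscrete, disjoint_principal_right, compl_compl]
    exact h
  refine ⟨(mem_codiscrete'.1 hcodisc).1, fun x => mem_closure_iff_frequently.2 ?_⟩
  exact (h x).frequently.filter_mono nhdsWithin_le_nhds

end DenseSets

section SimpleLaurent

variable {R : Type*} [Ring R] [Algebra ℂ R] {P Q S T : R} {a : ℂ}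

/-- The loop `1 + (a - 1) P + (a⁻¹ - 1) Q` in the coordinate `a = (z - p) / (z - q)` of the
Riemann sphere: up to the normalisation `1` at `a = 1`, this is the general form of a loop whose
only poles are simple ones at `a = 0` and `a = ∞`, that is at `z = p` and `z = q`. -/
noncomputable def simpleLaurent (P Q : R) (a : ℂ) : R := 1 + (a - 1) • P + (a⁻¹ - 1) • Q

lemma simpleLaurent_inv (P Q : R) (a : ℂ) : simpleLaurent P Q a⁻¹ = simpleLaurent Q P a := by
  rw [simpleLaurent, simpleLaurent, inv_inv, add_right_comm]

@[simp] lemma simpleLaurent_one (P Q : R) : simpleLaurent P Q 1 = 1 := by simp [simpleLaurent]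

@[simp] lemma simpleLaurent_zero_zero (a : ℂ) : simpleLaurent (0 : R) 0 a = 1 := by
  simp [simpleLaurent]

lemma simpleLaurent_mul (ha : a ≠ 0) (hPS : P * S = 0) (hQT : Q * T = 0) :
    simpleLaurent P Q a * simpleLaurent S T a =
      simpleLaurent (P + S - (P * T + Q * S)) (Q + T - (P * T + Q * S)) a := by
  have hcross : (a - 1) * (a⁻¹ - 1) = -((a - 1) + (a⁻¹ - 1)) := by field_simp; ring
  simp only [simpleLaurent, mul_add, add_mul, one_mul, mul_one, smul_mul_smul_comm, hPS, hQT,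
    smul_zero, hcross, mul_comm (a⁻¹ - 1) (a - 1)]
  module

lemma simpleLaurent_inj (h : ∀ a : ℂ, a ≠ 0 → a ≠ 1 → simpleLaurent P Q a = simpleLaurent S T a) :
    P = S ∧ Q = T := by
  have h2 := h 2 two_ne_zero (by norm_num)
  have h3 := h (-1) (by norm_num) (by norm_num)
  simp only [simpleLaurent] at h2 h3
  norm_num at h2 h3
  constructor
  · linear_combination (norm := module) (2 / 3 : ℂ) • h2 - (1 / 6 : ℂ) • h3
  · linear_combination (norm := module) (-2 / 3 : ℂ) • h2 - (1 / 3 : ℂ) • h3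

lemma map_simpleLaurent {R' : Type*} [Ring R'] [Algebra ℂ R'] (σ : R →+* R')
    (hσ : ∀ (c : ℂ) (x : R), σ (c • x) = starRingEnd ℂ c • σ x) (P Q : R) (a : ℂ) :
    σ (simpleLaurent P Q a) = simpleLaurent (σ P) (σ Q) (starRingEnd ℂ a) := by
  simp [simpleLaurent, hσ]

end SimpleLaurent

section MobiusCoordinate

variable {R : Type*} [NormedRing R] [NormedAlgebra ℂ R] {P Q : R} {p q : ℂ}

lemma hasDerivAt_simpleLaurent_one (P Q : R) : HasDerivAt (simpleLaurent P Q) (P - Q) 1 := by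
  have h₁ : HasDerivAt (fun a : ℂ => 1 + (a - 1) • P) P 1 := by
    simpa using (((hasDerivAt_id (1 : ℂ)).sub_const 1).smul_const P).const_add 1
  have h₂ : HasDerivAt (fun a : ℂ => (a⁻¹ - 1) • Q) (-Q) 1 := by
    simpa using ((hasDerivAt_inv (one_ne_zero (α := ℂ))).sub_const 1).smul_const Q
  simpa [sub_eq_add_neg] using! h₁.add h₂

lemma analyticAt_simpleLaurent {z : ℂ} {f : ℂ → ℂ} (P Q : R) (hf : AnalyticAt ℂ f z)
    (hz : f z ≠ 0) : AnalyticAt ℂ (fun z => simpleLaurent P Q (f z)) z :=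
  (analyticAt_const.add ((hf.sub analyticAt_const).smul analyticAt_const)).add
    (((hf.inv hz).sub analyticAt_const).smul analyticAt_const)

lemma analyticAt_sub_div_sub (p : ℂ) {q z : ℂ} (hz : z ≠ q) :
    AnalyticAt ℂ (fun z => (z - p) / (z - q)) z :=
  (analyticAt_id.sub analyticAt_const).div (analyticAt_id.sub analyticAt_const) (sub_ne_zero.2 hz)

lemma sub_div_sub_ne_zero {z : ℂ} (hz : z ∈ ({p, q}ᶜ : Set ℂ)) : (z - p) / (z - q) ≠ 0 := by
  obtain ⟨hp, hq⟩ : z ≠ p ∧ z ≠ q := by simpa using hz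
  exact div_ne_zero (sub_ne_zero.2 hp) (sub_ne_zero.2 hq)

lemma analyticAt_simpleLaurent_sub_div_sub (P Q : R) {z : ℂ} (hz : z ∈ ({p, q}ᶜ : Set ℂ)) :
    AnalyticAt ℂ (fun z => simpleLaurent P Q ((z - p) / (z - q))) z := by
  have hq : z ≠ q := by simp_all
  exact analyticAt_simpleLaurent P Q (analyticAt_sub_div_sub p hq) (sub_div_sub_ne_zero hz)

lemma meromorphicAt_simpleLaurent_sub_div_sub (P Q : R) (p q z : ℂ) :
    MeromorphicAt (fun z => simpleLaurent P Q ((z - p) / (z - q))) z := by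
  unfold simpleLaurent
  fun_prop

lemma meromorphicOrderAt_add_inv_sub_smul {E : Type*} [NormedAddCommGroup E] [NormedSpace ℂ E]
    {f : ℂ → E} {s : ℂ} {A : E} (hf : AnalyticAt ℂ f s) (hA : A ≠ 0) :
    meromorphicOrderAt (fun z => f z + (z - s)⁻¹ • A) s = -1 := by
  have hmer : MeromorphicAt (fun z => f z + (z - s)⁻¹ • A) s := by
    have := hf.meromorphicAt
    fun_prop
  refine (meromorphicOrderAt_eq_int_iff (n := -1) hmer).2
    ⟨fun z => (z - s) • f z + A, by fun_prop, by simpa using hA, ?_⟩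
  filter_upwards [self_mem_nhdsWithin] with z hz
  rw [zpow_neg_one, smul_add, inv_smul_smul₀ (sub_ne_zero.2 hz)]

lemma meromorphicOrderAt_simpleLaurent_sub_div_sub (hpq : p ≠ q) (P : R) (hQ : Q ≠ 0) :
    meromorphicOrderAt (fun z => simpleLaurent P Q ((z - p) / (z - q))) p = -1 := by
  have hreg : AnalyticAt ℂ (fun z => 1 + ((z - p) / (z - q) - 1) • P) p :=
    analyticAt_const.add (((analyticAt_sub_div_sub p hpq).sub analyticAt_const).smul
      analyticAt_const)
  rw [← meromorphicOrderAt_add_inv_sub_smul hreg (smul_ne_zero (sub_ne_zero.2 hpq) hQ)]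
  refine meromorphicOrderAt_congr ?_
  filter_upwards [self_mem_nhdsWithin] with z hz
  have hz : z - p ≠ 0 := sub_ne_zero.2 hz
  have hinv : ((z - p) / (z - q))⁻¹ - 1 = (z - p)⁻¹ * (p - q) := by
    rw [inv_div]; field_simp; ring
  rw [simpleLaurent, hinv, mul_smul]

lemma exists_sub_div_sub_eq (hpq : p ≠ q) {a : ℂ} (ha₀ : a ≠ 0) (ha₁ : a ≠ 1) :
    ∃ z ∈ ({p, q}ᶜ : Set ℂ), (z - p) / (z - q) = a := by
  have h₁ : 1 - a ≠ 0 := sub_ne_zero.2 ha₁.symm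
  have hpq : p - q ≠ 0 := sub_ne_zero.2 hpq
  have hp : (p - a * q) / (1 - a) - p = a * (p - q) / (1 - a) := by field_simp; ring
  have hq : (p - a * q) / (1 - a) - q = (p - q) / (1 - a) := by field_simp; ring
  refine ⟨(p - a * q) / (1 - a), ?_, by rw [hp, hq]; field_simp⟩
  simp only [Set.mem_compl_iff, Set.mem_insert_iff, Set.mem_singleton_iff, not_or,
    ← sub_eq_zero (b := p), ← sub_eq_zero (b := q), hp, hq]
  exact ⟨div_ne_zero (mul_ne_zero ha₀ hpq) h₁, div_ne_zero hpq h₁⟩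

theorem exists_eventuallyEq_simpleLaurent {f : ℂ → R} (hpq : p ≠ q)
    (hf : ∀ x, MeromorphicAt f x) (hp : -1 ≤ meromorphicOrderAt f p)
    (hq : -1 ≤ meromorphicOrderAt f q)
    (hord : ∀ x, x ≠ p → x ≠ q → 0 ≤ meromorphicOrderAt f x)
    (hlim : Tendsto f (Bornology.cobounded ℂ) (𝓝 1)) :
    ∃ P Q : R, ∀ x, f =ᶠ[𝓝[≠] x] fun z => simpleLaurent P Q ((z - p) / (z - q)) := by
  obtain ⟨A, hA⟩ := exists_eventuallyEq_partialFractions {p, q} hf (by simp [hp, hq])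
    (fun x hx => hord x (by grind) (by grind)) hlim
  refine ⟨(q - p)⁻¹ • A q, (p - q)⁻¹ • A p, fun x => ?_⟩
  filter_upwards [hA x, eventually_nhdsNE_mem_compl_pair p q x] with z hz hzpq
  obtain ⟨hzp, hzq⟩ : z ≠ p ∧ z ≠ q := by simpa using hzpq
  have hzp : z - p ≠ 0 := sub_ne_zero.2 hzp
  have hzq : z - q ≠ 0 := sub_ne_zero.2 hzq
  have hpq' : p - q ≠ 0 := sub_ne_zero.2 hpq
  have hqp : q - p ≠ 0 := sub_ne_zero.2 hpq.symm
  have hP : ((z - p) / (z - q) - 1) * (q - p)⁻¹ = (z - q)⁻¹ := by field_simp; ring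
  have hQ : (((z - p) / (z - q))⁻¹ - 1) * (p - q)⁻¹ = (z - p)⁻¹ := by
    rw [inv_div]; field_simp; ring
  rw [hz, Finset.sum_pair hpq, simpleLaurent, smul_smul, smul_smul, hP, hQ, add_assoc,
    add_comm (_ • A q)]

end MobiusCoordinate

lemma dot_comm (x y : V) : dot x y = dot y x := by
  simp only [dot, mul_comm]

@[simp] lemma dot_add_left (x y z : V) : dot (x + y) z = dot x z + dot y z := by
  simp [dot, add_mul, Finset.sum_add_distrib]

@[simp] lemma dot_smul_left (c : ℂ) (x y : V) : dot (c • x) y = c * dot x y := by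
  simp [dot, Finset.mul_sum, mul_assoc]

@[simp] lemma dot_add_right (x y z : V) : dot x (y + z) = dot x y + dot x z := by
  simp [dot, mul_add, Finset.sum_add_distrib]

@[simp] lemma dot_smul_right (c : ℂ) (x y : V) : dot x (c • y) = c * dot x y := by
  rw [dot_comm, dot_smul_left, dot_comm]

@[simp] lemma dot_zero_left (x : V) : dot 0 x = 0 := by simp [dot]

@[simp] lemma dot_zero_right (x : V) : dot x 0 = 0 := by simp [dot]

@[simp] lemma dot_neg_left (x y : V) : dot (-x) y = -dot x y := by simp [dot]

@[simp] lemma dot_neg_right (x y : V) : dot x (-y) = -dot x y := by simp [dot]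

@[simp] lemma dot_sub_left (x y z : V) : dot (x - y) z = dot x z - dot y z := by
  simp [sub_eq_add_neg]

@[simp] lemma dot_sub_right (x y z : V) : dot x (y - z) = dot x y - dot x z := by
  simp [sub_eq_add_neg]

@[simp] lemma imMul_add_left (x y z : V) : imMul (x + y) z = imMul x z + imMul y z := by
  ext i; fin_cases i <;> simp [imMul] <;> ring

@[simp] lemma imMul_add_right (x y z : V) : imMul x (y + z) = imMul x y + imMul x z := by
  ext i; fin_cases i <;> simp [imMul] <;> ring

@[simp] lemma imMul_smul_left (c : ℂ) (x y : V) : imMul (c • x) y = c • imMul x y := by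
  ext i; fin_cases i <;> simp [imMul] <;> ring

@[simp] lemma imMul_smul_right (c : ℂ) (x y : V) : imMul x (c • y) = c • imMul x y := by
  ext i; fin_cases i <;> simp [imMul] <;> ring

lemma imMul_anticomm (x y : V) : imMul x y = -imMul y x := by
  ext i; fin_cases i <;> simp [imMul] <;> ring

@[simp] lemma imMul_self (x : V) : imMul x x = 0 := by
  ext i; fin_cases i <;> simp [imMul] <;> ring

@[simp] lemma imMul_zero_left (x : V) : imMul 0 x = 0 := by
  simpa using imMul_smul_left 0 0 x

@[simp] lemma imMul_zero_right (x : V) : imMul x 0 = 0 := by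
  simpa using imMul_smul_right 0 x 0

@[simp] lemma imMul_neg_left (x y : V) : imMul (-x) y = -imMul x y := by
  simpa using imMul_smul_left (-1) x y

@[simp] lemma imMul_neg_right (x y : V) : imMul x (-y) = -imMul x y := by
  simpa using imMul_smul_right (-1) x y

@[simp] lemma imMul_sub_left (x y z : V) : imMul (x - y) z = imMul x z - imMul y z := by
  simp [sub_eq_add_neg]

@[simp] lemma imMul_sub_right (x y z : V) : imMul x (y - z) = imMul x y - imMul x z := by
  simp [sub_eq_add_neg]

lemma dot_imMul (x y z : V) : dot (imMul x y) z = dot x (imMul y z) := by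
  simp [imMul, dot, Fin.sum_univ_succ]
  ring

lemma imMul_imMul_polarized (x y z : V) :
    imMul x (imMul y z) + imMul y (imMul x z) =
      dot x z • y + dot y z • x - (2 * dot x y) • z := by
  ext i
  fin_cases i <;> simp [imMul, dot, Fin.sum_univ_succ] <;> ring

lemma imMul_imMul_self (x y : V) : imMul x (imMul x y) = dot x y • x - dot x x • y := by
  have h := imMul_imMul_polarized x x y
  have h2 : (2 : ℂ) • imMul x (imMul x y) = (2 : ℂ) • (dot x y • x - dot x x • y) := by
    linear_combination (norm := module) h
  exact smul_right_injective V (two_ne_zero : (2 : ℂ) ≠ 0) h2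

@[simp] lemma conjV_conjV (x : V) : conjV (conjV x) = x := by ext i; simp [conjV]

@[simp] lemma conjV_add (x y : V) : conjV (x + y) = conjV x + conjV y := by ext i; simp [conjV]

@[simp] lemma conjV_neg (x : V) : conjV (-x) = -conjV x := by ext i; simp [conjV]

@[simp] lemma conjV_zero : conjV 0 = 0 := by ext i; simp [conjV]

@[simp] lemma conjV_smul (c : ℂ) (x : V) :
    conjV (c • x) = (starRingEnd ℂ c) • conjV x := by ext i; simp [conjV]

@[simp] lemma conjV_eq_zero {x : V} : conjV x = 0 ↔ x = 0 := by
  constructor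
  · intro h; rw [← conjV_conjV x, h, conjV_zero]
  · rintro rfl; exact conjV_zero

lemma dot_conjV_conjV (x y : V) : dot (conjV x) (conjV y) = starRingEnd ℂ (dot x y) := by
  simp [dot, conjV]

lemma imMul_conjV_conjV (x y : V) : imMul (conjV x) (conjV y) = conjV (imMul x y) := by
  ext i
  fin_cases i <;> simp [imMul, conjV]

lemma inner_eq_dot (x y : V) : inner ℂ x y = dot (conjV x) y := by
  simp [PiLp.inner_apply, dot, conjV, mul_comm]

lemma dot_conjV_self_eq_zero {x : V} : dot (conjV x) x = 0 ↔ x = 0 := by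
  rw [← inner_eq_dot, inner_self_eq_zero]

section Eigenspaces

variable {u v w : V}

lemma dot_imMul_self_left (x y : V) : dot x (imMul x y) = 0 := by
  rw [← dot_imMul, imMul_self, dot_zero_left]

lemma dot_imMul_self_right (x y : V) : dot y (imMul x y) = 0 := by
  rw [imMul_anticomm, dot_neg_right, dot_imMul_self_left, neg_zero]

lemma dot_axis_eq_zero_of_imMul_eq_self (hu : imMul u w = u) : dot w u = 0 := by
  rw [← hu, dot_imMul_self_right]

lemma imMul_neg_axis_eq_self_iff : imMul u (-w) = u ↔ imMul u w = -u := by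
  rw [imMul_neg_right, neg_eq_iff_eq_neg]

lemma dot_axis_eq_zero_of_imMul_eq_neg (hv : imMul v w = -v) : dot w v = 0 := by
  simpa using dot_axis_eq_zero_of_imMul_eq_self (imMul_neg_axis_eq_self_iff.2 hv)

lemma dot_eq_zero_of_imMul_eq_self (hu : imMul u w = u) (hv : imMul v w = v) : dot u v = 0 := by
  have h : dot u v = -dot u v := by
    conv_lhs => rw [← hu, dot_imMul, imMul_anticomm w v, hv, dot_neg_right]
  exact CharZero.eq_neg_self_iff.1 h

lemma dot_eq_zero_of_imMul_eq_neg (hu : imMul u w = -u) (hv : imMul v w = -v) : dot u v = 0 :=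
  dot_eq_zero_of_imMul_eq_self (imMul_neg_axis_eq_self_iff.2 hu)
    (imMul_neg_axis_eq_self_iff.2 hv)

lemma imMul_eq_dot_smul_of_opposite (hu : imMul u w = u) (hv : imMul v w = -v) :
    imMul u v = dot u v • w := by
  have hwu := dot_axis_eq_zero_of_imMul_eq_self hu
  have hwv := dot_axis_eq_zero_of_imMul_eq_neg hv
  have e₁ := imMul_imMul_polarized u w v
  have e₂ := imMul_imMul_polarized v w u
  rw [imMul_anticomm w v, hv] at e₁
  rw [imMul_anticomm w u, hu, imMul_anticomm v u] at e₂
  simp only [neg_neg, imMul_neg_right, imMul_anticomm v u, dot_comm u w, dot_comm v w, hwu, hwv,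
    dot_comm v u] at e₁ e₂
  have h₂ : (2 : ℂ) • imMul u v = (2 : ℂ) • (dot u v • w) := by
    linear_combination (norm := module) e₁ + e₂
  exact smul_right_injective V (two_ne_zero : (2 : ℂ) ≠ 0) h₂

lemma imMul_imMul_eq_neg_of_imMul_eq_self (hu : imMul u w = u) (hv : imMul v w = v) :
    imMul (imMul u v) w = -imMul u v := by
  have hwu := dot_axis_eq_zero_of_imMul_eq_self hu
  have hwv := dot_axis_eq_zero_of_imMul_eq_self hv
  have e₁ := imMul_imMul_polarized u w v
  rw [imMul_anticomm w v, hv, dot_eq_zero_of_imMul_eq_self hu hv, hwv, dot_comm u w, hwu,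
    imMul_anticomm w (imMul u v), imMul_neg_right] at e₁
  linear_combination (norm := module) -e₁

lemma imMul_imMul_self_eq_zero_of_imMul_eq_self (hu : imMul u w = u) (hv : imMul v w = v) :
    imMul u (imMul u v) = 0 := by
  rw [imMul_imMul_self, dot_eq_zero_of_imMul_eq_self hu hv, dot_eq_zero_of_imMul_eq_self hu hu,
    zero_smul, zero_smul, sub_zero]

lemma exists_eq_add_add_smul_axis (hw : dot w w = -1) (x : V) :
    ∃ p n : V, ∃ c : ℂ, x = p + n + c • w ∧ imMul p w = p ∧ imMul n w = -n := by
  have hsq : imMul (imMul x w) w = x + dot w x • w := by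
    rw [imMul_anticomm, imMul_anticomm x w, imMul_neg_right, neg_neg, imMul_imMul_self, hw]
    module
  refine ⟨(1 / 2 : ℂ) • (x + dot w x • w + imMul x w), (1 / 2 : ℂ) • (x + dot w x • w - imMul x w),
    -dot w x, by module, ?_, ?_⟩
  all_goals
    simp only [imMul_smul_left, imMul_add_left, imMul_sub_left, imMul_self, hsq]
    module

end Eigenspaces

/-- Two isotropic vectors with pairing `1`. The product `imMul l l'` is the axis of the pair: right
multiplication by it has eigenvalue `1` at `l` and `-1` at `l'`. -/
structure NullPair (l l' : V) : Prop where
  left : dot l l = 0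
  right : dot l' l' = 0
  pairing : dot l l' = 1

namespace NullPair

variable {l l' u v : V}

lemma symm (h : NullPair l l') : NullPair l' l := ⟨h.right, h.left, by rw [dot_comm, h.pairing]⟩

lemma imMul_axis_left (h : NullPair l l') : imMul l (imMul l l') = l := by
  rw [imMul_imMul_self, h.pairing, h.left, one_smul, zero_smul, sub_zero]

lemma imMul_axis_right (h : NullPair l l') : imMul l' (imMul l l') = -l' := by
  rw [imMul_anticomm l l', imMul_neg_right, h.symm.imMul_axis_left]

lemma dot_axis_self (h : NullPair l l') : dot (imMul l l') (imMul l l') = -1 := by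
  rw [dot_imMul, h.imMul_axis_right, dot_neg_right, h.pairing]

lemma axis_ne_zero (h : NullPair l l') : imMul l l' ≠ 0 := fun h₀ => by
  simpa [h₀] using h.dot_axis_self

lemma imMul_axis_eq_neg_of_imMul_eq_zero (h : NullPair l l') (hz : imMul l u = 0)
    (hl : dot l u = 0) (hl' : dot l' u = 0) : imMul u (imMul l l') = -u := by
  have e₁ := imMul_imMul_polarized u l l'
  have e₂ := imMul_imMul_polarized l l' u
  rw [imMul_anticomm l' u] at e₂
  simp only [hz, imMul_zero_right, imMul_neg_right, dot_comm u, hl, hl', h.pairing] at e₁ e₂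
  linear_combination (norm := module) e₁ + e₂

lemma dot_smul_imMul_sub_dot_smul_imMul (h : NullPair l l') (hu : imMul u (imMul l l') = u)
    (hv : imMul v (imMul l l') = v) :
    dot l' u • imMul l v - dot l' v • imMul l u = imMul u v - dot l (imMul u v) • l' := by
  have hl := h.imMul_axis_left
  have hl' := h.imMul_axis_right
  have huv := imMul_imMul_eq_neg_of_imMul_eq_self hu hv
  have e₁ := imMul_imMul_polarized l l' (imMul u v)
  rw [imMul_eq_dot_smul_of_opposite hl huv, imMul_smul_right, hl',
    dot_eq_zero_of_imMul_eq_neg hl' huv, h.pairing] at e₁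
  have e₂ := imMul_imMul_polarized l' u v
  rw [imMul_anticomm l' v, imMul_eq_dot_smul_of_opposite hv hl', imMul_neg_right,
    imMul_smul_right, hu, dot_eq_zero_of_imMul_eq_self hu hv, dot_comm v l'] at e₂
  have e₃ : imMul l' (imMul u v) = (2 * dot l' v) • u - (2 * dot l' u) • v := by
    linear_combination (norm := module) e₂
  rw [e₃, imMul_sub_right, imMul_smul_right, imMul_smul_right] at e₁
  linear_combination (norm := module) (-1 / 2 : ℂ) • e₁

lemma eq_dot_smul_of_imMul_eq_zero (h : NullPair l l') (hu : imMul u (imMul l l') = u)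
    (hz : imMul l u = 0) : u = dot l' u • l := by
  have e := imMul_imMul_polarized l' l u
  rw [hz, imMul_zero_right, imMul_anticomm l' u, imMul_eq_dot_smul_of_opposite hu
    h.imMul_axis_right, imMul_neg_right, imMul_smul_right, h.imMul_axis_left,
    dot_eq_zero_of_imMul_eq_self h.imMul_axis_left hu, h.symm.pairing, dot_comm u l'] at e
  linear_combination (norm := module) (1 / 2 : ℂ) • e

end NullPair

section Dyads

/-- The rank-one operator `x ↦ ⟨v, x⟩ u` of the complex bilinear form. -/
noncomputable def dyad (u v : V) : V →L[ℂ] V := (innerSL ℂ (conjV v)).smulRight u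

@[simp] lemma dyad_apply (u v x : V) : dyad u v x = dot v x • u := by
  simp [dyad, inner_eq_dot]

lemma dyad_mul_dyad (u v x y : V) : dyad u v * dyad x y = dot v x • dyad u y := by
  ext1 z
  simp [smul_smul, mul_comm]

/-- The operator with eigenvalues `a` at `l`, `a⁻¹` at `l'` and `1` on the orthogonal complement of
a null pair `l`, `l'`. -/
noncomputable def boost (l l' : V) : ℂ → V →L[ℂ] V := simpleLaurent (dyad l l') (dyad l' l)

lemma boost_apply (l l' : V) (a : ℂ) (x : V) :
    boost l l' a x = x + ((a - 1) * dot l' x) • l + ((a⁻¹ - 1) * dot l x) • l' := by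
  simp [boost, simpleLaurent, smul_smul]

lemma boost_inv (l l' : V) (a : ℂ) : boost l l' a⁻¹ = boost l' l a := simpleLaurent_inv _ _ _

lemma boost_apply_of_dot_eq_zero {l l' x : V} (a : ℂ) (h : dot l x = 0) (h' : dot l' x = 0) :
    boost l l' a x = x := by
  simp [boost_apply, h, h']

end Dyads

namespace NullPair

variable {l l' u v : V} {a : ℂ}

lemma dyad_mul_self (h : NullPair l l') : dyad l l' * dyad l l' = dyad l l' := by
  rw [dyad_mul_dyad, h.symm.pairing, one_smul]

lemma dyad_mul_dyad_swap (h : NullPair l l') : dyad l l' * dyad l' l = 0 := by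
  ext1 x
  simp [h.right]

lemma boost_mul_boost_swap (h : NullPair l l') (ha : a ≠ 0) :
    boost l l' a * boost l' l a = 1 := by
  rw [boost, boost, simpleLaurent_mul ha h.dyad_mul_dyad_swap h.symm.dyad_mul_dyad_swap,
    h.dyad_mul_self, h.symm.dyad_mul_self, add_comm (dyad l' l), sub_self,
    simpleLaurent_zero_zero]

lemma dot_boost_boost (h : NullPair l l') (ha : a ≠ 0) (x y : V) :
    dot (boost l l' a x) (boost l l' a y) = dot x y := by
  simp only [boost_apply, dot_add_right, dot_smul_right, dot_add_left, dot_smul_left, h.left,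
    h.right, h.pairing, h.symm.pairing, dot_comm x l, dot_comm x l']
  linear_combination (dot l x * dot l' y + dot l' x * dot l y) * mul_inv_cancel₀ ha

lemma boost_apply_axis (l l' : V) (a : ℂ) : boost l l' a (imMul l l') = imMul l l' :=
  boost_apply_of_dot_eq_zero a (dot_imMul_self_left l l') (dot_imMul_self_right l l')

lemma imMul_boost_axis (h : NullPair l l') (a : ℂ) (x : V) :
    imMul (boost l l' a x) (imMul l l') = boost l l' a (imMul x (imMul l l')) := by
  have hl : dot l (imMul x (imMul l l')) = -dot l x := by
    rw [dot_comm, dot_imMul, imMul_anticomm, h.imMul_axis_left, dot_neg_right, dot_comm]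
  have hl' : dot l' (imMul x (imMul l l')) = dot l' x := by
    rw [dot_comm, dot_imMul, imMul_anticomm, h.imMul_axis_right, neg_neg, dot_comm]
  simp only [boost_apply, imMul_add_left, imMul_smul_left, h.imMul_axis_left, h.imMul_axis_right,
    hl, hl']
  module

lemma imMul_boost_boost (h : NullPair l l') (ha : a ≠ 0) (hu : imMul u (imMul l l') = u)
    (hv : imMul v (imMul l l') = v) :
    imMul (boost l l' a u) (boost l l' a v) = a • boost l l' a (imMul u v) := by
  have e := h.dot_smul_imMul_sub_dot_smul_imMul hu hv
  have hl'uv : dot l' (imMul u v) = 0 :=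
    dot_eq_zero_of_imMul_eq_neg h.imMul_axis_right (imMul_imMul_eq_neg_of_imMul_eq_self hu hv)
  simp only [boost_apply, hl'uv, dot_eq_zero_of_imMul_eq_self h.imMul_axis_left hu,
    dot_eq_zero_of_imMul_eq_self h.imMul_axis_left hv, imMul_add_left, imMul_add_right,
    imMul_smul_left, imMul_smul_right, imMul_self, imMul_anticomm u l]
  linear_combination (norm := module)
    (a - 1) • e - (mul_inv_cancel₀ ha * dot l (imMul u v)) • l'

end NullPair

/-- `T` belongs to the stabiliser of `w` in the complex orthogonal group, commutes with right
multiplication by `w` and scales products on the two eigenspaces of the latter by `c` and `c⁻¹`.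
The eigenspaces are dual three-dimensional representations and the product of two vectors of the
first one is their cross product, so `c` is the determinant of `T` on the first one. -/
structure IsAxialSimilitude (w : V) (c : ℂ) (T : V →L[ℂ] V) : Prop where
  map_axis : T w = w
  dot_map : ∀ x y, dot (T x) (T y) = dot x y
  imMul_map_axis : ∀ x, imMul (T x) w = T (imMul x w)
  imMul_map_pos : ∀ u v, imMul u w = u → imMul v w = v → imMul (T u) (T v) = c • T (imMul u v)
  imMul_map_neg : ∀ u v, imMul u w = -u → imMul v w = -v →
    imMul (T u) (T v) = c⁻¹ • T (imMul u v)

lemma NullPair.isAxialSimilitude_boost {l l' : V} {a : ℂ} (h : NullPair l l') (ha : a ≠ 0) :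
    IsAxialSimilitude (imMul l l') a (boost l l' a) where
  map_axis := boost_apply_axis l l' a
  dot_map := h.dot_boost_boost ha
  imMul_map_axis := h.imMul_boost_axis a
  imMul_map_pos _ _ := h.imMul_boost_boost ha
  imMul_map_neg u v hu hv := by
    rw [← imMul_neg_axis_eq_self_iff, ← imMul_anticomm] at hu hv
    simpa only [boost_inv] using h.symm.imMul_boost_boost (inv_ne_zero ha) hu hv

namespace IsAxialSimilitude

variable {w : V} {c d : ℂ} {S T : V →L[ℂ] V}

lemma mul (hT : IsAxialSimilitude w c T) (hS : IsAxialSimilitude w d S) :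
    IsAxialSimilitude w (c * d) (T * S) where
  map_axis := by rw [mul_apply_eq_comp, hS.map_axis, hT.map_axis]
  dot_map x y := by simp only [mul_apply_eq_comp, hT.dot_map, hS.dot_map]
  imMul_map_axis x := by
    simp only [mul_apply_eq_comp, hT.imMul_map_axis, hS.imMul_map_axis]
  imMul_map_pos u v hu hv := by
    simp only [mul_apply_eq_comp]
    rw [hT.imMul_map_pos _ _ (by rw [hS.imMul_map_axis, hu]) (by rw [hS.imMul_map_axis, hv]),
      hS.imMul_map_pos u v hu hv, map_smul, smul_smul]
  imMul_map_neg u v hu hv := by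
    simp only [mul_apply_eq_comp]
    rw [hT.imMul_map_neg _ _ (by rw [hS.imMul_map_axis, hu, map_neg])
      (by rw [hS.imMul_map_axis, hv, map_neg]),
      hS.imMul_map_neg u v hu hv, map_smul, smul_smul, mul_inv]

lemma imMul_map_opposite (hT : IsAxialSimilitude w c T) {u v : V} (hu : imMul u w = u)
    (hv : imMul v w = -v) : imMul (T u) (T v) = T (imMul u v) := by
  rw [imMul_eq_dot_smul_of_opposite (by rw [hT.imMul_map_axis, hu])
    (by rw [hT.imMul_map_axis, hv, map_neg]), imMul_eq_dot_smul_of_opposite hu hv, hT.dot_map,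
    map_smul, hT.map_axis]

theorem map_imMul (hT : IsAxialSimilitude w 1 T) (hw : dot w w = -1) (x y : V) :
    imMul (T x) (T y) = T (imMul x y) := by
  have swap {x y : V} (h : imMul (T x) (T y) = T (imMul x y)) :
      imMul (T y) (T x) = T (imMul y x) := by
    rw [imMul_anticomm, h, imMul_anticomm y x, map_neg]
  have haxis (x : V) : imMul (T x) (T w) = T (imMul x w) := by
    rw [hT.map_axis, hT.imMul_map_axis]
  obtain ⟨p, n, c, rfl, hp, hn⟩ := exists_eq_add_add_smul_axis hw x
  obtain ⟨q, m, d, rfl, hq, hm⟩ := exists_eq_add_add_smul_axis hw y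
  have hpq := hT.imMul_map_pos p q hp hq
  have hnm := hT.imMul_map_neg n m hn hm
  rw [inv_one, one_smul] at hnm
  rw [one_smul] at hpq
  simp only [map_add, map_smul, imMul_add_left, imMul_add_right, imMul_smul_left,
    imMul_smul_right, hpq, hnm, hT.imMul_map_opposite hp hm, swap (hT.imMul_map_opposite hq hn),
    haxis, swap (haxis _)]

end IsAxialSimilitude

section GroupG2

lemma InG2.dot_map_and_imMul_map {A : V →L[ℂ] V} (h : InG2 A) (x y : V) :
    dot (A x) (A y) = dot x y ∧ imMul (A x) (A y) = A (imMul x y) := by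
  obtain ⟨φ, hφ, hA⟩ := h
  have hone : φ (1, 0) = (1, 0) := by
    have hl (q : ℂ × V) : octMul (1, 0) q = q := by simp [octMul]
    have hr (q : ℂ × V) : octMul q (1, 0) = q := by simp [octMul]
    have e := hφ (1, 0) (φ.symm (1, 0))
    rw [hl, φ.apply_symm_apply, hr] at e
    exact e.symm
  have hφA (c : ℂ) (v : V) : φ (c, v) = (c, A v) := by
    have hcv : ((c, v) : ℂ × V) = c • (1, 0) + (0, v) := by simp
    rw [hcv, map_add, map_smul, hone, hA]
    simp
  have e := hφ (0, x) (0, y)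
  rw [hA, hA] at e
  simp only [octMul, zero_mul, zero_sub, zero_smul, zero_add] at e
  rw [hφA, Prod.mk.injEq, neg_inj] at e
  exact ⟨e.1.symm, e.2.symm⟩

lemma injective_of_dot_map {A : V →L[ℂ] V} (h : ∀ x y, dot (A x) (A y) = dot x y) :
    Function.Injective A := by
  refine (injective_iff_map_eq_zero A).2 fun x hx => dot_conjV_self_eq_zero.1 ?_
  rw [← h, hx, dot_zero_right]

theorem inG2_iff {A : V →L[ℂ] V} :
    InG2 A ↔ (∀ x y, dot (A x) (A y) = dot x y) ∧ ∀ x y, imMul (A x) (A y) = A (imMul x y) := by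
  refine ⟨fun h => ⟨fun x y => (h.dot_map_and_imMul_map x y).1,
    fun x y => (h.dot_map_and_imMul_map x y).2⟩, fun ⟨hdot, hmul⟩ => ?_⟩
  refine ⟨(LinearEquiv.refl ℂ ℂ).prodCongr
    (LinearEquiv.ofInjectiveEndo (A : V →ₗ[ℂ] V) (injective_of_dot_map hdot)), ?_, ?_⟩
  · rintro ⟨c, x⟩ ⟨d, y⟩
    simp [octMul, hdot, hmul]
  · intro v
    simp

/-- `imMul` as a continuous bilinear map. -/
noncomputable def imMulL : V →L[ℂ] V →L[ℂ] V :=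
  LinearMap.toContinuousBilinearMap (LinearMap.mk₂ ℂ imMul imMul_add_left imMul_smul_left
    imMul_add_right imMul_smul_right)

@[simp] lemma imMulL_apply (x y : V) : imMulL x y = imMul x y := by
  simp [imMulL]

lemma isClosed_setOf_inG2 : IsClosed {A : V →L[ℂ] V | InG2 A} := by
  simp only [inG2_iff, Set.ofPred_and, Set.ofPred_forall]
  refine .inter (isClosed_iInter fun x => isClosed_iInter fun y => isClosed_eq ?_ ?_)
    (isClosed_iInter fun x => isClosed_iInter fun y => isClosed_eq ?_ ?_)
  · unfold dot
    fun_prop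
  · fun_prop
  · simp only [← imMulL_apply]
    fun_prop
  · fun_prop

lemma map_imMul_of_hasDerivAt {T : ℂ → V →L[ℂ] V} {D : V →L[ℂ] V} {t : ℂ} (hT : HasDerivAt T D t)
    (ht : T t = 1) (x y : V)
    (h : ∀ᶠ s in 𝓝 t, imMul (T s x) (T s y) = T s (imMul x y)) :
    D (imMul x y) = imMul (D x) y + imMul x (D y) := by
  have hT' (v : V) : HasDerivAt (fun s => T s v) (D v) t := by
    simpa using hT.clm_apply (hasDerivAt_const t v)
  have hmul := imMulL.hasDerivAt_of_bilinear (fun _ => hT' x) (fun _ => hT' y)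
  simp only [imMulL_apply, ht, one_apply_eq_self] at hmul
  rw [add_comm]
  exact (hT' (imMul x y)).unique (hmul.congr_of_eventuallyEq (h.mono fun s hs => hs.symm))

lemma imMul_add_imMul_eq_zero_of_derivation {l l' m m' : V} {D : V →L[ℂ] V}
    (hD : D = dyad l l' - dyad l' l + (dyad m m' - dyad m' m))
    (h : ∀ x y, D (imMul x y) = imMul (D x) y + imMul x (D y)) :
    imMul l l' + imMul m m' = 0 := by
  have entry (i j k : Fin 7) :
      (D (imMul (EuclideanSpace.single i 1) (EuclideanSpace.single j 1))) k =
      (imMul (D (EuclideanSpace.single i 1)) (EuclideanSpace.single j 1) +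
        imMul (EuclideanSpace.single i 1) (D (EuclideanSpace.single j 1))) k := by rw [h]
  -- Each coordinate of the claim is a single matrix entry of the derivation rule.
  have h₀ := entry 4 5 3
  have h₁ := entry 0 6 5
  have h₂ := entry 0 6 4
  have h₃ := entry 0 1 2
  have h₄ := entry 1 3 6
  have h₅ := entry 2 1 4
  have h₆ := entry 3 2 5
  simp only [Fin.isValue, hD, imMul, PiLp.single_eq_same, ne_eq, Fin.reduceEq,
    not_false_eq_true, PiLp.single_eq_of_ne, mul_zero, sub_self, mul_one, add_zero, sub_zero,
    zero_add, add_apply, sub_apply, dyad_apply, dot, Fin.sum_univ_succ, Matrix.cons_val_zero,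
    Matrix.cons_val_succ, Fin.succ_zero_eq_one, Fin.succ_one_eq_two, Fin.reduceSucc,
    Finset.univ_unique, Fin.default_eq_zero, Matrix.cons_val_fin_one, Finset.sum_singleton,
    PiLp.add_apply, PiLp.sub_apply, PiLp.smul_apply, smul_eq_mul, PiLp.single_apply, mul_ite,
    Finset.sum_ite_eq', Finset.mem_univ, ↓reduceIte, zero_sub, neg_add_rev, neg_sub, one_mul,
    zero_mul, Matrix.cons_val, one_ne_zero, Finset.sum_const_zero, zero_ne_one, mul_neg, neg_smul,
    sub_neg_eq_add, PiLp.neg_apply] at h₀ h₁ h₂ h₃ h₄ h₅ h₆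
  ext i
  fin_cases i <;> simp [imMul]
  · linear_combination -h₀
  · linear_combination -h₁
  · linear_combination h₂
  · linear_combination -h₃
  · linear_combination -h₄
  · linear_combination -h₅
  · linear_combination -h₆

@[simp] lemma boost_zero_zero (a : ℂ) : boost 0 0 a = 1 := by
  ext1; simp [boost_apply]

theorem imMul_add_imMul_eq_zero_of_boost_mul_boost {l l' m m' : V}
    (h : ∀ᶠ a in 𝓝 1, InG2 (boost l l' a * boost m m' a)) :
    imMul l l' + imMul m m' = 0 := by
  have hderiv : HasDerivAt (fun a => boost l l' a * boost m m' a)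
      (dyad l l' - dyad l' l + (dyad m m' - dyad m' m)) 1 := by
    simpa [boost] using! (hasDerivAt_simpleLaurent_one (dyad l l') (dyad l' l)).mul
      (hasDerivAt_simpleLaurent_one (dyad m m') (dyad m' m))
  refine imMul_add_imMul_eq_zero_of_derivation rfl fun x y =>
    map_imMul_of_hasDerivAt hderiv (by simp [boost]) x y ?_
  exact h.mono fun a ha => (ha.dot_map_and_imMul_map x y).2

lemma NullPair.not_eventually_inG2_boost {l l' : V} (h : NullPair l l') :
    ¬ ∀ᶠ a in 𝓝 1, InG2 (boost l l' a) := fun hG => by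
  refine h.axis_ne_zero ?_
  simpa using imMul_add_imMul_eq_zero_of_boost_mul_boost (m := 0) (m' := 0) (by simpa using hG)

theorem NullPair.inG2_boost_mul_boost_swap {l l' m m' : V} {a : ℂ} (hl : NullPair l l')
    (hm : NullPair m m') (hlm : imMul l l' = imMul m m') (ha : a ≠ 0) :
    InG2 (boost l l' a * boost m' m a) := by
  have hm' := hm.isAxialSimilitude_boost (inv_ne_zero ha)
  rw [boost_inv, ← hlm] at hm'
  have h := (hl.isAxialSimilitude_boost ha).mul hm'
  rw [mul_inv_cancel₀ ha] at h
  exact inG2_iff.2 ⟨h.dot_map, h.map_imMul hl.dot_axis_self⟩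

end GroupG2

section OrthogonalProjections

open Submodule in
lemma starProjection_sup_of_isOrtho {𝕜 E : Type*} [RCLike 𝕜] [NormedAddCommGroup E]
    [InnerProductSpace 𝕜 E] {U W : Submodule 𝕜 E} [U.HasOrthogonalProjection]
    [W.HasOrthogonalProjection] [(U ⊔ W).HasOrthogonalProjection] (h : U ⟂ W) :
    (U ⊔ W).starProjection = U.starProjection + W.starProjection := by
  ext1 x
  apply eq_starProjection_of_mem_orthogonal
  · exact add_mem_sup (starProjection_apply_mem _ _) (starProjection_apply_mem _ _)
  · rw [← inf_orthogonal, add_apply]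
    constructor
    · rw [← sub_sub]
      exact sub_mem (sub_starProjection_mem_orthogonal x) (h.symm (starProjection_apply_mem _ _))
    · rw [add_comm, ← sub_sub]
      exact sub_mem (sub_starProjection_mem_orthogonal x) (h (starProjection_apply_mem _ _))

end OrthogonalProjections

section Subspaces

variable {l k : V} {U W : Submodule ℂ V}

lemma mem_conjSub {x : V} : x ∈ conjSub W ↔ conjV x ∈ W := Iff.rfl

lemma conjSub_conjSub (W : Submodule ℂ V) : conjSub (conjSub W) = W := by
  ext x
  simp [mem_conjSub]

lemma conjSub_span_singleton (l : V) : conjSub (ℂ ∙ l) = ℂ ∙ conjV l := by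
  ext x
  simp only [mem_conjSub, Submodule.mem_span_singleton]
  constructor
  · rintro ⟨c, hc⟩
    exact ⟨starRingEnd ℂ c, by rw [← conjV_smul, hc, conjV_conjV]⟩
  · rintro ⟨c, hc⟩
    exact ⟨starRingEnd ℂ c, by rw [← hc, conjV_smul, conjV_conjV]⟩

lemma gc_conjSub : GaloisConnection conjSub conjSub := fun U W =>
  ⟨fun h x hx => h (by simpa [mem_conjSub] using hx),
    fun h x hx => by simpa [mem_conjSub] using h (mem_conjSub.1 hx)⟩

lemma conjSub_sup (U W : Submodule ℂ V) : conjSub (U ⊔ W) = conjSub U ⊔ conjSub W :=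
  gc_conjSub.l_sup

lemma perp_eq_orthogonal (W : Submodule ℂ V) : perp W = (conjSub W)ᗮ := by
  ext x
  refine ⟨fun h y hy => ?_, fun h y hy => ?_⟩
  · rw [inner_eq_dot, dot_comm]
    exact h _ hy
  · have h' := h (conjV y) (by simpa [mem_conjSub] using hy)
    rwa [inner_eq_dot, conjV_conjV, dot_comm] at h'

lemma perp_sup_conjSub (W : Submodule ℂ V) : perp (W ⊔ conjSub W) = (W ⊔ conjSub W)ᗮ := by
  rw [perp_eq_orthogonal, conjSub_sup, conjSub_conjSub, sup_comm]

lemma span_singleton_le_perp_span_singleton :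
    (ℂ ∙ k) ≤ perp (ℂ ∙ l) ↔ dot l k = 0 := by
  rw [Submodule.span_singleton_le_iff_mem]
  refine ⟨fun h => dot_comm l k ▸ h l (Submodule.mem_span_singleton_self l), fun h y hy => ?_⟩
  obtain ⟨c, rfl⟩ := Submodule.mem_span_singleton.1 hy
  rw [dot_smul_right, dot_comm, h, mul_zero]

lemma isOrtho_span_singleton : (ℂ ∙ l) ⟂ (ℂ ∙ k) ↔ dot (conjV l) k = 0 := by
  simp [Submodule.isOrtho_span, inner_eq_dot]

lemma isIsotropic_span_singleton : IsIsotropic (ℂ ∙ l) ↔ dot l l = 0 := by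
  refine ⟨fun h => h l (Submodule.mem_span_singleton_self l) l
    (Submodule.mem_span_singleton_self l), fun h x hx y hy => ?_⟩
  obtain ⟨c, rfl⟩ := Submodule.mem_span_singleton.1 hx
  obtain ⟨d, rfl⟩ := Submodule.mem_span_singleton.1 hy
  simp [h]

lemma isIsotropicLine_span_singleton (hl : l ≠ 0) : IsIsotropicLine (ℂ ∙ l) ↔ dot l l = 0 := by
  rw [IsIsotropicLine, finrank_span_singleton hl, isIsotropic_span_singleton]
  exact and_iff_right rfl

lemma IsIsotropic.isOrtho_conjSub (h : IsIsotropic W) : W ⟂ conjSub W := by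
  rw [Submodule.isOrtho_comm, Submodule.isOrtho_iff_inner_eq]
  intro x hx y hy
  rw [inner_eq_dot]
  exact h _ hx _ hy

lemma exists_nullPair_conjV_of_dot_self_eq_zero {v : V} (hv : v ≠ 0) (hvv : dot v v = 0) :
    ∃ c : ℂ, c ≠ 0 ∧ NullPair (c • v) (conjV (c • v)) := by
  have hn : (‖v‖ : ℂ) ≠ 0 := by simpa using hv
  have hd : dot v (conjV v) = (‖v‖ : ℂ) ^ 2 := by
    rw [dot_comm, ← inner_eq_dot, inner_self_eq_norm_sq_to_K]
    rfl
  refine ⟨(‖v‖ : ℂ)⁻¹, inv_ne_zero hn, ?_, ?_, ?_⟩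
  · simp [hvv]
  · simp [dot_conjV_conjV, hvv]
  · simp only [conjV_smul, dot_smul_left, dot_smul_right, hd, map_inv₀, Complex.conj_ofReal]
    field_simp

lemma IsIsotropicLine.exists_eq_span_singleton {L : Submodule ℂ V} (h : IsIsotropicLine L) :
    ∃ l, NullPair l (conjV l) ∧ L = ℂ ∙ l := by
  obtain ⟨v, hvL, hv⟩ := L.exists_mem_ne_zero_of_ne_bot (by rintro rfl; simpa using h.1)
  obtain ⟨c, hc, hl⟩ := exists_nullPair_conjV_of_dot_self_eq_zero hv (h.2 v hvL v hvL)
  refine ⟨c • v, hl, (Submodule.eq_of_le_of_finrank_eq ?_ ?_).symm⟩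
  · exact (Submodule.span_singleton_le_iff_mem _ _).2 (L.smul_mem c hvL)
  · rw [h.1, finrank_span_singleton (smul_ne_zero hc hv)]

end Subspaces

namespace NullPair

variable {l l' k k' : V}

lemma conj (h : NullPair l (conjV l)) : NullPair (conjV l) (conjV (conjV l)) := by
  rw [conjV_conjV]
  exact h.symm

lemma ne_zero (h : NullPair l l') : l ≠ 0 := by
  rintro rfl
  simpa using h.pairing

lemma isIsotropicLine_span_singleton (h : NullPair l l') : IsIsotropicLine (ℂ ∙ l) :=
  (G2Loop.isIsotropicLine_span_singleton h.ne_zero).2 h.left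

lemma norm_eq_one (h : NullPair l (conjV l)) : ‖l‖ = 1 := by
  have hsq : (‖l‖ : ℂ) ^ 2 = 1 := by
    rw [← h.symm.pairing, ← inner_eq_dot, inner_self_eq_norm_sq_to_K]
    rfl
  exact (pow_eq_one_iff_of_nonneg (norm_nonneg _) two_ne_zero).1 (by exact_mod_cast hsq)

lemma starProjection_span_singleton (h : NullPair l (conjV l)) :
    (ℂ ∙ l).starProjection = dyad l (conjV l) := by
  ext1 x
  rw [Submodule.starProjection_unit_singleton ℂ h.norm_eq_one, inner_eq_dot, dyad_apply]

lemma starProjection_conjSub_span_singleton (h : NullPair l (conjV l)) :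
    (conjSub (ℂ ∙ l)).starProjection = dyad (conjV l) l := by
  have h' := h.conj.starProjection_span_singleton
  rw [conjV_conjV] at h'
  simp only [conjSub_span_singleton, h']

lemma axis_eq_neg_of_imMul_axis_eq_neg (hk : NullPair k (conjV k))
    (h : imMul k (imMul l (conjV l)) = -k) : imMul k (conjV k) = -imMul l (conjV l) := by
  have h' : imMul (conjV k) (imMul l (conjV l)) = conjV k := by
    have e := congrArg conjV h
    rw [← imMul_conjV_conjV, ← imMul_conjV_conjV, conjV_conjV, imMul_anticomm (conjV l),
      imMul_neg_right, conjV_neg] at e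
    exact neg_inj.1 e
  rw [imMul_anticomm, imMul_eq_dot_smul_of_opposite h' h, hk.symm.pairing, one_smul]

lemma axis_eq_axis_conj_iff (hk : NullPair k (conjV k)) :
    imMul l (conjV l) = imMul (conjV k) k ↔ imMul k (imMul l (conjV l)) = -k := by
  refine ⟨fun h => h ▸ hk.symm.imMul_axis_right, fun h => ?_⟩
  rw [imMul_anticomm (conjV k), hk.axis_eq_neg_of_imMul_axis_eq_neg h, neg_neg]

end NullPair

section CoassociativePlanes

variable {l k : V}

lemma isCoassociative_span_sup_span {n : V} (hl₀ : l ≠ 0) (hn₀ : n ≠ 0) (hl : dot l l = 0)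
    (hn : dot n n = 0) (ho : dot (conjV l) n = 0) (hm : imMul l n = 0) :
    IsCoassociative ((ℂ ∙ l) ⊔ (ℂ ∙ n)) := by
  have hln : dot l n = 0 := by
    have e := imMul_imMul_self l n
    rw [hm, hl, imMul_zero_right, zero_smul, sub_zero] at e
    exact (smul_eq_zero.1 e.symm).resolve_right hl₀
  refine ⟨?_, fun x hx y hy => ?_, fun x hx y hy => ?_⟩
  · have hdim := Submodule.finrank_sup_add_finrank_inf_eq (ℂ ∙ l) (ℂ ∙ n)
    rwa [(isOrtho_span_singleton.2 ho).disjoint.eq_bot, finrank_bot, finrank_span_singleton hl₀,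
      finrank_span_singleton hn₀] at hdim
  all_goals
    rw [← Submodule.span_insert, Submodule.mem_span_pair] at hx hy
    obtain ⟨a, b, rfl⟩ := hx
    obtain ⟨c, d, rfl⟩ := hy
  · simp [hl, hn, hln, dot_comm n l]
  · simp [hm, imMul_anticomm n l]

lemma finrank_le_two_of_imMul_eq_zero {N : Submodule ℂ V} (hd : IsIsotropic N)
    (hm : ∀ x ∈ N, ∀ y ∈ N, imMul x y = 0) : Module.finrank ℂ N ≤ 2 := by
  by_contra! hlt
  let e := stdOrthonormalBasis ℂ N
  have hin (i j) : dot (conjV (e i : V)) (e j : V) = if i = j then 1 else 0 := by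
    rw [← inner_eq_dot, ← Submodule.coe_inner]
    exact orthonormal_iff_ite.1 e.orthonormal i j
  have hp (i) : NullPair (e i : V) (conjV (e i : V)) := by
    refine ⟨hd _ (e i).2 _ (e i).2, ?_, ?_⟩
    · rw [dot_conjV_conjV, hd _ (e i).2 _ (e i).2, map_zero]
    · rw [dot_comm, hin, if_pos rfl]
  have haxis (i j) (hij : i ≠ j) :
      imMul (e j : V) (conjV (e j)) = -imMul (e i : V) (conjV (e i)) :=
    (hp j).axis_eq_neg_of_imMul_axis_eq_neg <|
      (hp i).imMul_axis_eq_neg_of_imMul_eq_zero (hm _ (e i).2 _ (e j).2)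
        (hd _ (e i).2 _ (e j).2) (by rw [hin, if_neg hij])
  have h₀₁ := haxis ⟨0, by omega⟩ ⟨1, by omega⟩ (by simp)
  have h₀₂ := haxis ⟨0, by omega⟩ ⟨2, by omega⟩ (by simp)
  have h₁₂ := haxis ⟨1, by omega⟩ ⟨2, by omega⟩ (by simp)
  rw [h₁₂, h₀₁, neg_neg] at h₀₂
  exact (hp _).axis_ne_zero (by linear_combination (norm := module) (1 / 2 : ℂ) • h₀₂)

lemma NullPair.pairPlane_span_singleton (h : NullPair l (conjV l)) (h₀ : dot (conjV l) k = 0) :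
    pairPlane (ℂ ∙ l) (ℂ ∙ k) = (ℂ ∙ l) ⊔ (ℂ ∙ (k - dot l k • conjV l)) := by
  rw [pairPlane, Submodule.map_span, Set.image_singleton]
  congr 3
  simp only [perp_sup_conjSub, ContinuousLinearMap.coe_coe, Submodule.starProjection_orthogonal',
    starProjection_sup_of_isOrtho (isIsotropic_span_singleton.2 h.left).isOrtho_conjSub]
  simp [h.starProjection_span_singleton, h.starProjection_conjSub_span_singleton, h₀]

lemma NullPair.span_singleton_eq_conjSub_iff (hl : NullPair l (conjV l)) (hk : k ≠ 0) :
    (ℂ ∙ k) = conjSub (ℂ ∙ l) ↔ k - dot l k • conjV l = 0 := by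
  rw [conjSub_span_singleton]
  refine ⟨fun h => ?_, fun h => ?_⟩
  · obtain ⟨c, rfl⟩ := Submodule.mem_span_singleton.1 (h ▸ Submodule.mem_span_singleton_self k)
    rw [dot_smul_right, hl.pairing, mul_one, sub_self]
  · rw [sub_eq_zero] at h
    have hc : dot l k ≠ 0 := fun hc => hk (by rw [h, hc, zero_smul])
    rw [h, Submodule.span_singleton_smul_eq hc.isUnit]

theorem NullPair.pairCondition_span_singleton_iff (hl : NullPair l (conjV l))
    (hk : NullPair k (conjV k)) :
    PairCondition (ℂ ∙ l) (ℂ ∙ k) ↔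
      (ℂ ∙ k) ≠ conjSub (ℂ ∙ l) ∧ imMul k (imMul l (conjV l)) = -k := by
  rw [PairCondition, conjSub_span_singleton, span_singleton_le_perp_span_singleton,
    ← conjSub_span_singleton, Ne, hl.span_singleton_eq_conjSub_iff hk.ne_zero]
  constructor
  · rintro ⟨h₀, hC⟩
    rw [hl.pairPlane_span_singleton h₀] at hC
    refine ⟨fun hn => ?_, ?_⟩
    · have hdim := hC.1
      rw [hn, Submodule.span_zero_singleton, sup_bot_eq, finrank_span_singleton hl.ne_zero] at hdim
      exact absurd hdim (by norm_num)
    · have hz := hC.2.2 l (Submodule.mem_sup_left (Submodule.mem_span_singleton_self l)) _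
        (Submodule.mem_sup_right (Submodule.mem_span_singleton_self _))
      have hn := hl.imMul_axis_eq_neg_of_imMul_eq_zero hz (by simp [hl.pairing])
        (by simp [h₀, hl.right])
      rw [imMul_sub_left, imMul_smul_left, hl.imMul_axis_right] at hn
      linear_combination (norm := module) hn
  · rintro ⟨hn, hk'⟩
    have h₀ : dot (conjV l) k = 0 := dot_eq_zero_of_imMul_eq_neg hl.imMul_axis_right hk'
    rw [hl.pairPlane_span_singleton h₀]
    refine ⟨h₀, isCoassociative_span_sup_span hl.ne_zero hn hl.left ?_ ?_ ?_⟩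
    · simp [hk.left, hl.right, dot_comm k (conjV l), h₀]
    · simp [h₀, hl.right]
    · rw [imMul_sub_right, imMul_smul_right,
        imMul_eq_dot_smul_of_opposite hl.imMul_axis_left hk', sub_self]

end CoassociativePlanes

section Conjugation

/-- The complex conjugate `Ā` of an operator `A`, that is `Ā v = conj (A (conj v))`. -/
noncomputable def conjOp : (V →L[ℂ] V) →+* (V →L[ℂ] V) where
  toFun A := LinearMap.toContinuousLinearMap
    { toFun x := conjV (A (conjV x))
      map_add' x y := by simp
      map_smul' c x := by simp }
  map_one' := by ext1; simp
  map_mul' A B := by ext1; simp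
  map_zero' := by ext1; simp
  map_add' A B := by ext1; simp

@[simp] lemma conjOp_apply (A : V →L[ℂ] V) (x : V) : conjOp A x = conjV (A (conjV x)) := rfl

@[simp] lemma conjOp_conjOp (A : V →L[ℂ] V) : conjOp (conjOp A) = A := by
  ext1
  simp

lemma conjOp_smul (c : ℂ) (A : V →L[ℂ] V) : conjOp (c • A) = starRingEnd ℂ c • conjOp A := by
  ext1
  simp

lemma conjOp_dyad (u v : V) : conjOp (dyad u v) = dyad (conjV u) (conjV v) := by
  ext1 x
  rw [conjOp_apply, dyad_apply, conjV_smul, ← dot_conjV_conjV, conjV_conjV, dyad_apply]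

lemma conjOp_simpleLaurent (P Q : V →L[ℂ] V) (a : ℂ) :
    conjOp (simpleLaurent P Q a) = simpleLaurent (conjOp P) (conjOp Q) (starRingEnd ℂ a) :=
  map_simpleLaurent conjOp conjOp_smul P Q a

end Conjugation

section Splitting

variable {P Q : V →L[ℂ] V}

lemma eq_zero_of_forall_laurent_eq_zero {E : Type*} [AddCommGroup E] [Module ℂ E] {u v w w' : E}
    (h : ∀ a : ℂ, a ≠ 0 →
      (a - 1) ^ 2 • u + (a⁻¹ - 1) ^ 2 • v + (a - 1) • w + (a⁻¹ - 1) • w' = 0) :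
    u = 0 ∧ w = 0 := by
  have h₁ := h (-1) (by norm_num)
  have h₂ := h 2 two_ne_zero
  have h₃ := h 2⁻¹ (by norm_num)
  have h₄ := h (-2) (by norm_num)
  constructor
  · linear_combination (norm := module)
      (-1 / 9 : ℂ) • h₁ + (2 / 9 : ℂ) • h₂ + (4 / 45 : ℂ) • h₃ + (2 / 15 : ℂ) • h₄
  · linear_combination (norm := module)
      (-1 / 18 : ℂ) • h₁ + (7 / 9 : ℂ) • h₂ + (8 / 45 : ℂ) • h₃ - (1 / 15 : ℂ) • h₄

lemma dot_eq_zero_of_dot_simpleLaurent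
    (h : ∀ a : ℂ, a ≠ 0 → ∀ x y, dot (simpleLaurent P Q a x) (simpleLaurent P Q a y) = dot x y)
    (x y : V) :
    dot (P x) (P y) = 0 ∧ dot (P x) (y - Q y) + dot (x - Q x) (P y) = 0 := by
  refine eq_zero_of_forall_laurent_eq_zero (v := dot (Q x) (Q y))
    (w' := dot (Q x) (y - P y) + dot (x - P x) (Q y)) fun a ha => ?_
  have e := h a ha x y
  have hcross : (a - 1) * (a⁻¹ - 1) = -((a - 1) + (a⁻¹ - 1)) := by field_simp; ring
  simp only [simpleLaurent, add_apply, smul_apply, one_apply_eq_self, dot_add_left, dot_add_right,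
    dot_smul_left, dot_smul_right] at e
  simp only [dot_sub_left, dot_sub_right, smul_eq_mul]
  linear_combination e - hcross * (dot (P x) (Q y) + dot (Q x) (P y))

lemma imMul_eq_zero_of_imMul_simpleLaurent
    (h : ∀ a : ℂ, a ≠ 0 → ∀ x y, imMul (simpleLaurent P Q a x) (simpleLaurent P Q a y) =
      simpleLaurent P Q a (imMul x y)) (x y : V) :
    imMul (P x) (P y) = 0 := by
  refine (eq_zero_of_forall_laurent_eq_zero (v := imMul (Q x) (Q y))
    (w := imMul (P x) (y - Q y) + imMul (x - Q x) (P y) - P (imMul x y))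
    (w' := imMul (Q x) (y - P y) + imMul (x - P x) (Q y) - Q (imMul x y)) fun a ha => ?_).1
  have e := h a ha x y
  have hcross : (a - 1) * (a⁻¹ - 1) = -((a - 1) + (a⁻¹ - 1)) := by field_simp; ring
  simp only [simpleLaurent, add_apply, smul_apply, one_apply_eq_self, imMul_add_left,
    imMul_add_right, imMul_smul_left, imMul_smul_right] at e
  simp only [imMul_sub_left, imMul_sub_right]
  linear_combination (norm := module) e - hcross • (imMul (P x) (Q y) + imMul (Q x) (P y))

lemma finrank_range_le_two (h : ∀ a : ℂ, a ≠ 0 → InG2 (simpleLaurent P Q a)) :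
    Module.finrank ℂ (LinearMap.range (P : V →ₗ[ℂ] V)) ≤ 2 := by
  apply finrank_le_two_of_imMul_eq_zero
  · rintro _ ⟨x, rfl⟩ _ ⟨y, rfl⟩
    exact (dot_eq_zero_of_dot_simpleLaurent (fun a ha => (inG2_iff.1 (h a ha)).1) x y).1
  · rintro _ ⟨x, rfl⟩ _ ⟨y, rfl⟩
    exact imMul_eq_zero_of_imMul_simpleLaurent (fun a ha => (inG2_iff.1 (h a ha)).2) x y

/-- The leading coefficient of the loop `boost l̄ l * simpleLaurent P P̄`. Since `boost l̄ l` is the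
inverse of `boost l l̄`, this is what remains of `P` when `boost l l̄` is split off on the left. -/
noncomputable def boostMulCoeff (l : V) (P : V →L[ℂ] V) : V →L[ℂ] V :=
  dyad (conjV l) l + P - (dyad (conjV l) l * conjOp P + dyad l (conjV l) * P)

lemma boostMulCoeff_apply (l : V) (P : V →L[ℂ] V) (x : V) :
    boostMulCoeff l P x = dot l (x - conjOp P x) • conjV l + (P x - dot (conjV l) (P x) • l) := by
  simp only [boostMulCoeff, add_apply, sub_apply, mul_apply_eq_comp, dyad_apply, dot_sub_right]
  module

lemma boost_mul_simpleLaurent {l : V} {a : ℂ} (ha : a ≠ 0) (hP : ∀ x, dot l (P x) = 0) :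
    boost (conjV l) l a * simpleLaurent P (conjOp P) a =
      simpleLaurent (boostMulCoeff l P) (conjOp (boostMulCoeff l P)) a := by
  have hlP : dyad (conjV l) l * P = 0 := by
    ext1 x
    simp [hP]
  have hlP' : dyad l (conjV l) * conjOp P = 0 := by
    simpa [conjOp_dyad] using congrArg conjOp hlP
  rw [boost, simpleLaurent_mul ha hlP hlP', boostMulCoeff]
  simp only [map_add, map_sub, map_mul, conjOp_dyad, conjOp_conjOp, conjV_conjV]
  rw [add_comm (dyad l (conjV l) * P)]

theorem exists_eq_boost_mul_simpleLaurent
    (h : ∀ a : ℂ, a ≠ 0 → ∀ x y,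
      dot (simpleLaurent P (conjOp P) a x) (simpleLaurent P (conjOp P) a y) = dot x y)
    (hP : P ≠ 0) :
    ∃ (l : V) (R : V →L[ℂ] V), NullPair l (conjV l) ∧
      (∀ a : ℂ, a ≠ 0 → simpleLaurent P (conjOp P) a =
        boost l (conjV l) a * simpleLaurent R (conjOp R) a) ∧
      (∀ a : ℂ, a ≠ 0 → ∀ x y,
        dot (simpleLaurent R (conjOp R) a x) (simpleLaurent R (conjOp R) a y) = dot x y) ∧
      LinearMap.ker (P : V →ₗ[ℂ] V) < LinearMap.ker (R : V →ₗ[ℂ] V) := by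
  obtain ⟨x₀, hx₀⟩ : ∃ x₀, P x₀ ≠ 0 := by
    by_contra! h₀
    exact hP (ContinuousLinearMap.ext h₀)
  have hdot := fun x y => dot_eq_zero_of_dot_simpleLaurent h x y
  obtain ⟨c, -, hl⟩ := exists_nullPair_conjV_of_dot_self_eq_zero hx₀ (hdot x₀ x₀).1
  have hsplit := fun (a : ℂ) (ha : a ≠ 0) =>
    boost_mul_simpleLaurent (l := c • P x₀) (P := P) ha fun x => by simp [(hdot x₀ x).1]
  refine ⟨c • P x₀, boostMulCoeff (c • P x₀) P, hl, fun a ha => ?_, fun a ha x y => ?_,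
    SetLike.lt_iff_le_and_exists.2 ⟨fun y hy => ?_, x₀, ?_, hx₀⟩⟩
  · rw [← hsplit a ha, ← mul_assoc, hl.boost_mul_boost_swap ha, one_mul]
  · rw [← hsplit a ha, mul_apply_eq_comp, mul_apply_eq_comp, hl.symm.dot_boost_boost ha, h a ha]
  · have hy : P y = 0 := hy
    have e : dot (P x₀) (y - conjOp P y) = 0 := by simpa [hy] using (hdot x₀ y).2
    change boostMulCoeff _ P y = 0
    rw [boostMulCoeff_apply, dot_smul_left, e, hy]
    simp
  · have e := (hdot x₀ x₀).2
    rw [dot_comm (x₀ - _), ← two_mul, mul_eq_zero_iff_left two_ne_zero] at e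
    have hpair : c * dot (conjV (c • P x₀)) (P x₀) = 1 := by
      rw [← dot_smul_right, hl.symm.pairing]
    change boostMulCoeff _ P x₀ = 0
    rw [boostMulCoeff_apply, dot_smul_left, e, smul_smul, mul_comm _ c, hpair]
    simp

theorem exists_eq_boost_mul_boost
    (h : ∀ a : ℂ, a ≠ 0 → InG2 (simpleLaurent P (conjOp P) a)) (hP : P ≠ 0) :
    ∃ l k : V, NullPair l (conjV l) ∧ NullPair k (conjV k) ∧ ∀ a : ℂ, a ≠ 0 →
      simpleLaurent P (conjOp P) a = boost l (conjV l) a * boost k (conjV k) a := by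
  obtain ⟨l, R, hl, hPR, hRdot, hker⟩ :=
    exists_eq_boost_mul_simpleLaurent (fun a ha => (inG2_iff.1 (h a ha)).1) hP
  have hR : R ≠ 0 := by
    rintro rfl
    refine hl.not_eventually_inG2_boost ((eventually_ne_nhds one_ne_zero).mono fun a ha => ?_)
    simpa [hPR a ha] using h a ha
  obtain ⟨k, S, hk, hRS, -, hker'⟩ := exists_eq_boost_mul_simpleLaurent hRdot hR
  have hS : S = 0 := by
    have hrank := LinearMap.finrank_range_add_finrank_ker (P : V →ₗ[ℂ] V)
    have hrange := finrank_range_le_two h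
    have hlt := Submodule.finrank_lt_finrank_of_lt hker
    have hlt' := Submodule.finrank_lt_finrank_of_lt hker'
    rw [finrank_euclideanSpace_fin] at hrank
    have hseven : 7 ≤ Module.finrank ℂ (LinearMap.ker (S : V →ₗ[ℂ] V)) := by linarith
    have htop : LinearMap.ker (S : V →ₗ[ℂ] V) = ⊤ := Submodule.eq_top_of_finrank_eq
      (le_antisymm (Submodule.finrank_le _) (finrank_euclideanSpace_fin.trans_le hseven))
    exact ContinuousLinearMap.coe_injective (LinearMap.ker_eq_top.1 htop)
  refine ⟨l, k, hl, hk, fun a ha => ?_⟩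
  rw [hPR a ha, hRS a ha, hS, map_zero, simpleLaurent_zero_zero, mul_one]

end Splitting

section SimpleFactors

open scoped ComplexConjugate

variable {α z : ℂ} {l : V} {L K W : Submodule ℂ V}

lemma simpleFactor_eq_simpleLaurent (h : IsIsotropic W) (α z : ℂ) :
    simpleFactor α W z =
      simpleLaurent W.starProjection (conjSub W).starProjection ((z - α) / (z - conj α)) := by
  simp only [simpleFactor, perp_sup_conjSub, Submodule.starProjection_orthogonal',
    starProjection_sup_of_isOrtho h.isOrtho_conjSub, simpleLaurent, inv_div]
  module

lemma NullPair.simpleFactor_span_singleton (h : NullPair l (conjV l)) (α z : ℂ) :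
    simpleFactor α (ℂ ∙ l) z = boost l (conjV l) ((z - α) / (z - conj α)) := by
  rw [simpleFactor_eq_simpleLaurent h.isIsotropicLine_span_singleton.2,
    h.starProjection_span_singleton, h.starProjection_conjSub_span_singleton, boost]

lemma isOrtho_conjSub_conjSub (h : L ⟂ K) : conjSub L ⟂ conjSub K := by
  rw [Submodule.isOrtho_iff_inner_eq] at h ⊢
  intro x hx y hy
  rw [← conjV_conjV x, ← conjV_conjV y, inner_eq_dot, dot_conjV_conjV, ← inner_eq_dot,
    h _ (mem_conjSub.1 hx) _ (mem_conjSub.1 hy), map_zero]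

lemma IsIsotropic.conjSub (h : IsIsotropic W) : IsIsotropic (conjSub W) := fun x hx y hy => by
  simpa [dot_conjV_conjV] using h _ (mem_conjSub.1 hx) _ (mem_conjSub.1 hy)

lemma simpleFactor_mul_simpleFactor_conjSub (h : IsIsotropic W)
    (hz : z ∈ ({α, conj α}ᶜ : Set ℂ)) :
    simpleFactor α W z * simpleFactor α (G2Loop.conjSub W) z = 1 := by
  have hW := h.isOrtho_conjSub.starProjection_comp_starProjection
  have hW' := h.isOrtho_conjSub.symm.starProjection_comp_starProjection
  rw [simpleFactor_eq_simpleLaurent h, simpleFactor_eq_simpleLaurent h.conjSub, conjSub_conjSub,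
    simpleLaurent_mul (sub_div_sub_ne_zero hz) hW hW']
  simp only [(Submodule.isIdempotentElem_starProjection _).eq, sub_self,
    add_comm (G2Loop.conjSub W).starProjection, simpleLaurent_zero_zero]

lemma simpleFactor_sup (h : IsIsotropic (L ⊔ K)) (ho : L ⟂ K)
    (hz : z ∈ ({α, conj α}ᶜ : Set ℂ)) :
    simpleFactor α (L ⊔ K) z = simpleFactor α L z * simpleFactor α K z := by
  have hL : IsIsotropic L := fun x hx y hy =>
    h x (Submodule.mem_sup_left hx) y (Submodule.mem_sup_left hy)
  have hK : IsIsotropic K := fun x hx y hy =>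
    h x (Submodule.mem_sup_right hx) y (Submodule.mem_sup_right hy)
  have hsup := h.isOrtho_conjSub
  rw [conjSub_sup] at hsup
  have hLK' : L ⟂ conjSub K := hsup.mono le_sup_left le_sup_right
  have hL'K : conjSub L ⟂ K := (hsup.mono le_sup_right le_sup_left).symm
  have ho' : conjSub L ⟂ conjSub K := isOrtho_conjSub_conjSub ho
  have hLK'₀ : L.starProjection * (conjSub K).starProjection = 0 :=
    hLK'.starProjection_comp_starProjection
  have hL'K₀ : (conjSub L).starProjection * K.starProjection = 0 :=
    hL'K.starProjection_comp_starProjection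
  rw [simpleFactor_eq_simpleLaurent h, simpleFactor_eq_simpleLaurent hL,
    simpleFactor_eq_simpleLaurent hK, simpleLaurent_mul (sub_div_sub_ne_zero hz)
      ho.starProjection_comp_starProjection ho'.starProjection_comp_starProjection, hLK'₀, hL'K₀,
    conjSub_sup, starProjection_sup_of_isOrtho ho, starProjection_sup_of_isOrtho ho', add_zero,
    sub_zero, sub_zero]

end SimpleFactors

section Density

variable {p q : ℂ} {X : Type*} [TopologicalSpace X]

lemma forall_mem_of_dense_sub_div_sub {Φ : ℂ → X} {F : Set X} {U : Set ℂ} (hpq : p ≠ q)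
    (hΦ : ContinuousOn Φ {0}ᶜ) (hF : IsClosed F) (hU : Dense U)
    (h : ∀ z ∈ U, Φ ((z - p) / (z - q)) ∈ F) (a : ℂ) (ha₀ : a ≠ 0) (ha₁ : a ≠ 1) : Φ a ∈ F := by
  obtain ⟨z, hz, rfl⟩ := exists_sub_div_sub_eq hpq ha₀ ha₁
  have hq : z ≠ q := by simp_all
  have hcont : ContinuousAt (fun z => Φ ((z - p) / (z - q))) z :=
    ContinuousAt.comp (g := Φ) (hΦ.continuousAt (isOpen_compl_singleton.mem_nhds ha₀))
      (analyticAt_sub_div_sub p hq).continuousAt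
  exact hF.mem_of_frequently_of_tendsto ((mem_closure_iff_frequently.1 (hU z)).mono h) hcont

lemma continuousOn_simpleLaurent {R : Type*} [NormedRing R] [NormedAlgebra ℂ R] (P Q : R) :
    ContinuousOn (simpleLaurent P Q) {0}ᶜ := fun _ ha =>
  (analyticAt_simpleLaurent P Q analyticAt_id ha).continuousAt.continuousWithinAt

lemma LoopEq.refl (f : ℂ → V →L[ℂ] V) : LoopEq f f :=
  ⟨Set.univ, isOpen_univ, dense_univ, fun _ _ => rfl⟩

lemma LoopEq.symm {f g : ℂ → V →L[ℂ] V} (h : LoopEq f g) : LoopEq g f :=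
  let ⟨U, ho, hd, hU⟩ := h
  ⟨U, ho, hd, fun z hz => (hU z hz).symm⟩

lemma LoopEq.trans {f g h : ℂ → V →L[ℂ] V} (hfg : LoopEq f g) (hgh : LoopEq g h) :
    LoopEq f h :=
  let ⟨U, ho, hd, hU⟩ := hfg
  let ⟨U', ho', hd', hU'⟩ := hgh
  ⟨U ∩ U', ho.inter ho', hd.inter_of_isOpen_left hd' ho,
    fun z hz => (hU z hz.1).trans (hU' z hz.2)⟩

lemma loopEq_of_eqOn_compl_pair {f g : ℂ → V →L[ℂ] V} (p q : ℂ)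
    (h : Set.EqOn f g ({p, q}ᶜ : Set ℂ)) : LoopEq f g :=
  let ⟨ho, hd⟩ := isOpen_dense_of_eventually_nhdsNE (eventually_nhdsNE_mem_compl_pair p q)
  ⟨_, ho, hd, h⟩

end Density

section SimpleLoops

open scoped ComplexConjugate

variable {α : ℂ} {P Q : V →L[ℂ] V} {f g : ℂ → V →L[ℂ] V}

/-- The general form of a loop that satisfies the reality condition, takes the value `1` at `∞`
and has at most simple poles at `α` and `ᾱ` and no others: `P` and `P̄` are its coefficients in
the coordinate `(z - α) / (z - ᾱ)`. -/
noncomputable def simpleLoop (α : ℂ) (P : V →L[ℂ] V) (z : ℂ) : V →L[ℂ] V :=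
  simpleLaurent P (conjOp P) ((z - α) / (z - conj α))

lemma conjOp_simpleLaurent_conj (α : ℂ) (P Q : V →L[ℂ] V) (z : ℂ) :
    conjOp (simpleLaurent P Q ((conj z - α) / (conj z - conj α))) =
      simpleLaurent (conjOp Q) (conjOp P) ((z - α) / (z - conj α)) := by
  rw [conjOp_simpleLaurent, ← simpleLaurent_inv (conjOp P)]
  simp

lemma ne_conj_of_im_ne_zero (hα : α.im ≠ 0) : α ≠ conj α := fun h =>
  hα (Complex.conj_eq_iff_im.1 h.symm)

theorem isNegRealG2Loop_of_eqOn_simpleLoop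
    (hf : Set.EqOn f (simpleLoop α P) ({α, conj α}ᶜ : Set ℂ))
    (hG : ∀ a : ℂ, a ≠ 0 → InG2 (simpleLaurent P (conjOp P) a)) : IsNegRealG2Loop f := by
  obtain ⟨ho, hd⟩ := isOpen_dense_of_eventually_nhdsNE
    (eventually_nhdsNE_mem_compl_pair α (conj α))
  have hneg : ∃ h : ℂ → V →L[ℂ] V, AnalyticAt ℂ h 0 ∧ h 0 = ContinuousLinearMap.id ℂ V ∧
      ∀ᶠ w in 𝓝[≠] (0 : ℂ), f w⁻¹ = h w := by
    refine ⟨fun w => simpleLaurent P (conjOp P) ((1 - α * w) / (1 - conj α * w)),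
      analyticAt_simpleLaurent P (conjOp P) (by fun_prop (disch := simp)) (by simp),
      by simp [ContinuousLinearMap.one_def], ?_⟩
    have hne (c : ℂ) : ∀ᶠ w in 𝓝[≠] (0 : ℂ), w⁻¹ ≠ c :=
      tendsto_inv₀_nhdsNE_zero.eventually (Bornology.eventually_ne_cobounded c)
    filter_upwards [self_mem_nhdsWithin, hne α, hne (conj α)] with w hw h₁ h₂
    have hw : w ≠ 0 := hw
    rw [hf (by simp [h₁, h₂]), simpleLoop, ← mul_div_mul_right _ _ hw, sub_mul, sub_mul,
      inv_mul_cancel₀ hw]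
  have hinfty : MeromorphicAt (fun w => f w⁻¹) 0 := by
    obtain ⟨h, hh, -, he⟩ := hneg
    exact hh.meromorphicAt.congr (he.mono fun w hw => hw.symm)
  refine ⟨⟨⟨_, ho, hd, fun z hz => ?_, fun z hz => ?_⟩, fun z => ?_, hinfty⟩,
    ⟨_, ho, hd, fun z hz v => ?_⟩, hneg⟩
  · exact (analyticAt_simpleLaurent_sub_div_sub P (conjOp P) hz).differentiableAt
      |>.differentiableWithinAt.congr hf (hf hz)
  · exact hf hz ▸ hG _ (sub_div_sub_ne_zero hz)
  · exact (meromorphicAt_simpleLaurent_sub_div_sub P (conjOp P) α (conj α) z).congr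
      ((eventually_nhdsNE_mem_compl_pair α (conj α) z).mono fun w hw => (hf hw).symm)
  · have hz' : conj z ∈ ({α, conj α}ᶜ : Set ℂ) := by
      have hconj : conj z = α ↔ z = conj α := by
        rw [← (starRingEnd ℂ).injective.eq_iff, Complex.conj_conj]
      simpa [hconj, (starRingEnd ℂ).injective.eq_iff, and_comm] using hz
    rw [hf hz', hf hz, ← conjOp_apply, simpleLoop, conjOp_simpleLaurent_conj, conjOp_conjOp,
      simpleLoop]

theorem onlySimplePoles_of_eqOn_simpleLoop (hα : α.im ≠ 0) (hP : P ≠ 0)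
    (hf : Set.EqOn f (simpleLoop α P) ({α, conj α}ᶜ : Set ℂ)) : OnlySimplePoles f α := by
  have hP' : conjOp P ≠ 0 := fun h => hP (by rw [← conjOp_conjOp P, h, map_zero])
  have horder (z : ℂ) : meromorphicOrderAt f z = meromorphicOrderAt (simpleLoop α P) z :=
    meromorphicOrderAt_congr
      ((eventually_nhdsNE_mem_compl_pair α (conj α) z).mono fun w hw => hf hw)
  have hα := ne_conj_of_im_ne_zero hα
  have hswap : simpleLoop α P =
      fun z => simpleLaurent (conjOp P) P ((z - conj α) / (z - α)) := by
    ext1 z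
    rw [simpleLoop, ← inv_div, simpleLaurent_inv]
  refine ⟨?_, ?_, fun z h₁ h₂ => ?_⟩
  · rw [horder]
    exact meromorphicOrderAt_simpleLaurent_sub_div_sub hα P hP'
  · rw [horder, hswap]
    exact meromorphicOrderAt_simpleLaurent_sub_div_sub hα.symm _ hP
  · rw [horder]
    exact (analyticAt_simpleLaurent_sub_div_sub P (conjOp P)
      (by simp [h₁, h₂])).meromorphicOrderAt_nonneg

lemma eq_conjOp_of_reality (hα : α.im ≠ 0) {U : Set ℂ} (hU : Dense U)
    (h : ∀ z ∈ U, conjOp (simpleLaurent P Q ((conj z - α) / (conj z - conj α))) =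
      simpleLaurent P Q ((z - α) / (z - conj α))) : Q = conjOp P := by
  refine (simpleLaurent_inj (P := P) (S := conjOp Q) fun a ha₀ ha₁ => sub_eq_zero.1 ?_).2
  refine forall_mem_of_dense_sub_div_sub (ne_conj_of_im_ne_zero hα)
    ((continuousOn_simpleLaurent P Q).sub (continuousOn_simpleLaurent (conjOp Q) (conjOp P)))
    isClosed_singleton hU (fun z hz => ?_) a ha₀ ha₁
  rw [Set.mem_singleton_iff, Pi.sub_apply, ← h z hz, conjOp_simpleLaurent_conj, sub_self]

lemma inG2_of_dense (hα : α.im ≠ 0) {Φ : ℂ → V →L[ℂ] V} (hΦ : ContinuousOn Φ {0}ᶜ)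
    (hΦ₁ : Φ 1 = 1) (hg : IsRationalG2Loop g)
    (h : LoopEq g fun z => Φ ((z - α) / (z - conj α))) (a : ℂ) (ha : a ≠ 0) : InG2 (Φ a) := by
  obtain rfl | ha₁ := eq_or_ne a 1
  · rw [hΦ₁]
    exact inG2_iff.2 ⟨fun x y => rfl, fun x y => rfl⟩
  obtain ⟨U, ho, hd, -, hU⟩ := hg.groupValued
  obtain ⟨U', -, hd', hU'⟩ := h
  refine forall_mem_of_dense_sub_div_sub (ne_conj_of_im_ne_zero hα) hΦ isClosed_setOf_inG2
    (hd.inter_of_isOpen_left hd' ho) (fun z hz => ?_) a ha ha₁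
  have hgz : g z = Φ ((z - α) / (z - conj α)) := hU' z hz.2
  exact hgz ▸ hU z hz.1

lemma IsNegRealG2Loop.tendsto_cobounded (hg : IsNegRealG2Loop g) :
    Tendsto g (Bornology.cobounded ℂ) (𝓝 1) := by
  obtain ⟨h, hh, h₀, he⟩ := hg.negative
  have hlim : Tendsto h (𝓝[≠] 0) (𝓝 1) := by
    simpa [h₀, ContinuousLinearMap.one_def] using
      hh.continuousAt.tendsto.mono_left nhdsWithin_le_nhds
  simpa [Function.comp_def] using
    (hlim.congr' (he.mono fun w hw => hw.symm)).comp tendsto_inv₀_cobounded'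

theorem IsNegRealG2Loop.exists_loopEq_simpleLoop (hα : α.im ≠ 0) (hg : IsNegRealG2Loop g)
    (hpole : OnlySimplePoles g α) : ∃ P ≠ 0, LoopEq g (simpleLoop α P) := by
  obtain ⟨P, Q, hPQ⟩ := exists_eventuallyEq_simpleLaurent (ne_conj_of_im_ne_zero hα)
    hg.meromorphic hpole.1.ge hpole.2.1.ge hpole.2.2 hg.tendsto_cobounded
  obtain ⟨ho, hd⟩ := isOpen_dense_of_eventually_nhdsNE hPQ
  obtain ⟨U, -, hUd, hU⟩ := hg.reality
  have hQ : Q = conjOp P := by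
    have hoc := ho.preimage Complex.continuous_conj
    have hdc := hd.preimage Complex.conjCLE.toHomeomorph.isOpenMap
    refine eq_conjOp_of_reality hα
      ((hd.inter_of_isOpen_left hdc ho).inter_of_isOpen_left hUd (ho.inter hoc))
      fun z ⟨⟨hz, hz'⟩, hzU⟩ => ?_
    ext1 v
    have hz : g z = simpleLaurent P Q ((z - α) / (z - conj α)) := hz
    have hz' : g (conj z) = simpleLaurent P Q ((conj z - α) / (conj z - conj α)) := hz'
    rw [conjOp_apply, ← hz, ← hz']
    exact hU z hzU v
  subst hQ
  refine ⟨P, ?_, _, ho, hd, fun z hz => hz⟩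
  rintro rfl
  have horder := hpole.1
  simp only [meromorphicOrderAt_congr (hPQ α), map_zero, simpleLaurent_zero_zero] at horder
  exact absurd (horder ▸ analyticAt_const.meromorphicOrderAt_nonneg) (by decide)

end SimpleLoops

section Products

open scoped ComplexConjugate

variable {α : ℂ} {k l : V} {K L : Submodule ℂ V} {g : ℂ → V →L[ℂ] V}

theorem NullPair.forall_inG2_boost_mul_boost_iff (hl : NullPair l (conjV l))
    (hk : NullPair k (conjV k)) :
    (∀ a : ℂ, a ≠ 0 → InG2 (boost l (conjV l) a * boost k (conjV k) a)) ↔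
      imMul k (imMul l (conjV l)) = -k := by
  rw [← hk.axis_eq_axis_conj_iff]
  refine ⟨fun h => ?_, fun h a ha => hl.inG2_boost_mul_boost_swap hk.symm h ha⟩
  rw [imMul_anticomm (conjV k), eq_neg_iff_add_eq_zero]
  exact imMul_add_imMul_eq_zero_of_boost_mul_boost ((eventually_ne_nhds one_ne_zero).mono h)

lemma NullPair.exists_boost_mul_boost_eq_simpleLaurent (hk : NullPair k (conjV k))
    (h₀ : dot (conjV l) k = 0) (hne : k - dot l k • conjV l ≠ 0) :
    ∃ S ≠ 0, ∀ a : ℂ, a ≠ 0 →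
      boost l (conjV l) a * boost k (conjV k) a = simpleLaurent S (conjOp S) a := by
  refine ⟨boostMulCoeff (conjV l) (dyad k (conjV k)), fun h => hne ?_, fun a ha => ?_⟩
  · simpa [boostMulCoeff_apply, conjOp_dyad, h₀, hk.left, dot_comm (conjV k), hk.pairing]
      using congrArg (· k) h
  · rw [← boost_mul_simpleLaurent ha (by simp [h₀]), conjV_conjV, conjOp_dyad, conjV_conjV]
    rfl

theorem PairCondition.exists_eqOn_simpleLoop (hL : IsIsotropicLine L) (hK : IsIsotropicLine K)
    (h : PairCondition L K) (α : ℂ) :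
    ∃ S ≠ 0, Set.EqOn (fun z => simpleFactor α L z * simpleFactor α K z) (simpleLoop α S)
        ({α, conj α}ᶜ : Set ℂ) ∧
      ∀ a : ℂ, a ≠ 0 → InG2 (simpleLaurent S (conjOp S) a) := by
  obtain ⟨l, hl, rfl⟩ := hL.exists_eq_span_singleton
  obtain ⟨k, hk, rfl⟩ := hK.exists_eq_span_singleton
  obtain ⟨hne, hlk⟩ := (hl.pairCondition_span_singleton_iff hk).1 h
  have h₀ : dot (conjV l) k = 0 := dot_eq_zero_of_imMul_eq_neg hl.imMul_axis_right hlk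
  rw [Ne, hl.span_singleton_eq_conjSub_iff hk.ne_zero] at hne
  obtain ⟨S, hS, hSa⟩ := hk.exists_boost_mul_boost_eq_simpleLaurent h₀ hne
  refine ⟨S, hS, fun z hz => ?_, fun a ha => ?_⟩
  · simp only [hl.simpleFactor_span_singleton, hk.simpleFactor_span_singleton, simpleLoop,
      hSa _ (sub_div_sub_ne_zero hz)]
  · exact hSa a ha ▸ (hl.forall_inG2_boost_mul_boost_iff hk).2 hlk a ha

theorem PairCondition.isNegRealG2Loop (hL : IsIsotropicLine L) (hK : IsIsotropicLine K)
    (h : PairCondition L K) (α : ℂ) :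
    IsNegRealG2Loop fun z => simpleFactor α L z * simpleFactor α K z :=
  let ⟨_, _, hS, hG⟩ := h.exists_eqOn_simpleLoop hL hK α
  isNegRealG2Loop_of_eqOn_simpleLoop hS hG

theorem PairCondition.onlySimplePoles (hL : IsIsotropicLine L) (hK : IsIsotropicLine K)
    (h : PairCondition L K) (hα : α.im ≠ 0) :
    OnlySimplePoles (fun z => simpleFactor α L z * simpleFactor α K z) α :=
  let ⟨_, hS₀, hS, _⟩ := h.exists_eqOn_simpleLoop hL hK α
  onlySimplePoles_of_eqOn_simpleLoop hα hS₀ hS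

theorem pairCondition_of_isRationalG2Loop (hα : α.im ≠ 0) (hL : IsIsotropicLine L)
    (hK : IsIsotropicLine K) (hne : K ≠ conjSub L) (hg : IsRationalG2Loop g)
    (h : LoopEq g fun z => simpleFactor α L z * simpleFactor α K z) : PairCondition L K := by
  obtain ⟨l, hl, rfl⟩ := hL.exists_eq_span_singleton
  obtain ⟨k, hk, rfl⟩ := hK.exists_eq_span_singleton
  rw [hl.pairCondition_span_singleton_iff hk, ← hl.forall_inG2_boost_mul_boost_iff hk]
  simp only [hl.simpleFactor_span_singleton, hk.simpleFactor_span_singleton] at h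
  exact ⟨hne, inG2_of_dense hα
    ((continuousOn_simpleLaurent _ _).mul (continuousOn_simpleLaurent _ _))
    (by simp [boost]) hg h⟩

lemma ne_conjSub_of_loopEq (hα : α.im ≠ 0) (hg : IsNegRealG2Loop g)
    (hpole : OnlySimplePoles g α) (hL : IsIsotropic L)
    (h : LoopEq g fun z => simpleFactor α L z * simpleFactor α K z) : K ≠ conjSub L := by
  rintro rfl
  obtain ⟨P, hP, hgP⟩ := hg.exists_loopEq_simpleLoop hα hpole
  have hone : LoopEq (simpleLoop α P) fun _ => 1 := hgP.symm.trans <| h.trans <|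
    loopEq_of_eqOn_compl_pair α (conj α) fun _ hz => simpleFactor_mul_simpleFactor_conjSub hL hz
  obtain ⟨U, -, hU, hU₁⟩ := hone
  refine hP (simpleLaurent_inj (Q := conjOp P) (S := 0) (T := 0) fun a ha₀ ha₁ => ?_).1
  rw [simpleLaurent_zero_zero]
  exact forall_mem_of_dense_sub_div_sub (ne_conj_of_im_ne_zero hα)
    (continuousOn_simpleLaurent P (conjOp P)) isClosed_singleton hU hU₁ a ha₀ ha₁

theorem IsNegRealG2Loop.pairCondition_of_loopEq (hα : α.im ≠ 0) (hg : IsNegRealG2Loop g)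
    (hpole : OnlySimplePoles g α) (hL : IsIsotropicLine L) (hK : IsIsotropicLine K)
    (h : LoopEq g fun z => simpleFactor α L z * simpleFactor α K z) : PairCondition L K :=
  pairCondition_of_isRationalG2Loop hα hL hK (ne_conjSub_of_loopEq hα hg hpole hL.2 h)
    hg.toIsRationalG2Loop h

theorem IsNegRealG2Loop.exists_loopEq_simpleFactor_mul_simpleFactor (hα : α.im ≠ 0)
    (hg : IsNegRealG2Loop g) (hpole : OnlySimplePoles g α) :
    ∃ L K : Submodule ℂ V, IsIsotropicLine L ∧ IsIsotropicLine K ∧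
      LoopEq g fun z => simpleFactor α L z * simpleFactor α K z := by
  obtain ⟨P, hP, hgP⟩ := hg.exists_loopEq_simpleLoop hα hpole
  have hG : ∀ a : ℂ, a ≠ 0 → InG2 (simpleLaurent P (conjOp P) a) :=
    inG2_of_dense hα (continuousOn_simpleLaurent _ _) (simpleLaurent_one _ _)
      hg.toIsRationalG2Loop hgP
  obtain ⟨l, k, hl, hk, hlk⟩ := exists_eq_boost_mul_boost hG hP
  refine ⟨ℂ ∙ l, ℂ ∙ k, hl.isIsotropicLine_span_singleton, hk.isIsotropicLine_span_singleton,
    hgP.trans (loopEq_of_eqOn_compl_pair α (conj α) fun z hz => ?_)⟩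
  simp only [simpleLoop, hlk _ (sub_div_sub_ne_zero hz), hl.simpleFactor_span_singleton,
    hk.simpleFactor_span_singleton]

end Products

section CoassociativePlanes

open scoped ComplexConjugate

variable {α : ℂ} {K L R : Submodule ℂ V}

lemma isOrtho_of_le_perp (h : K ≤ perp (L ⊔ conjSub L)) : L ⟂ K := by
  rw [perp_sup_conjSub, ← Submodule.isOrtho_iff_le] at h
  exact (h.mono_right le_sup_left).symm

lemma pairPlane_eq_sup (h : K ≤ perp (L ⊔ conjSub L)) : pairPlane L K = L ⊔ K := by
  have hmap : Set.EqOn (perp (L ⊔ conjSub L)).starProjection id K := fun x hx =>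
    Submodule.starProjection_eq_self_iff.2 (h hx)
  exact congrArg (L ⊔ ·) (SetLike.coe_injective hmap.image_eq_self)

theorem PairCondition.exists_completing_line (hL : IsIsotropicLine L) (hK : IsIsotropicLine K)
    (h : PairCondition L K) :
    ∃ R : Submodule ℂ V, IsIsotropicLine R ∧ L ⟂ R ∧ conjSub R ⟂ K ∧
      IsCoassociative (L ⊔ R) ∧ IsCoassociative (conjSub R ⊔ K) := by
  obtain ⟨l, hl, rfl⟩ := hL.exists_eq_span_singleton
  obtain ⟨k, hk, rfl⟩ := hK.exists_eq_span_singleton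
  obtain ⟨hne, hlk⟩ := (hl.pairCondition_span_singleton_iff hk).1 h
  have hK' : imMul (conjV k) (imMul l (conjV l)) = conjV k :=
    hk.axis_eq_axis_conj_iff.2 hlk ▸ hk.symm.imMul_axis_left
  have hr := imMul_imMul_eq_neg_of_imMul_eq_self hl.imMul_axis_left hK'
  have hlr := imMul_imMul_self_eq_zero_of_imMul_eq_self hl.imMul_axis_left hK'
  have hkr : imMul (conjV k) (imMul l (conjV k)) = 0 := by
    rw [imMul_anticomm l, imMul_neg_right,
      imMul_imMul_self_eq_zero_of_imMul_eq_self hK' hl.imMul_axis_left, neg_zero]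
  have hr₀ : imMul l (conjV k) ≠ 0 := fun h₀ => by
    refine hne ((hl.span_singleton_eq_conjSub_iff hk.ne_zero).2 (sub_eq_zero.2 ?_))
    simpa [dot_conjV_conjV] using congrArg conjV (hl.eq_dot_smul_of_imMul_eq_zero hK' h₀)
  have hrr := dot_eq_zero_of_imMul_eq_neg hr hr
  have hlr' := dot_eq_zero_of_imMul_eq_neg hl.imMul_axis_right hr
  have hrk := dot_eq_zero_of_imMul_eq_neg hr hlk
  refine ⟨ℂ ∙ imMul l (conjV k), (isIsotropicLine_span_singleton hr₀).2 hrr,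
    isOrtho_span_singleton.2 hlr', ?_,
    isCoassociative_span_sup_span hl.ne_zero hr₀ hl.left hrr hlr' hlr, ?_⟩
  · rwa [conjSub_span_singleton, isOrtho_span_singleton, conjV_conjV]
  · rw [conjSub_span_singleton]
    refine isCoassociative_span_sup_span (by simpa using hr₀) hk.ne_zero
      (by rw [dot_conjV_conjV, hrr, map_zero]) hk.left (by rwa [conjV_conjV]) ?_
    rw [imMul_anticomm, ← conjV_conjV k, imMul_conjV_conjV, conjV_conjV, hkr]
    simp

lemma loopEq_simpleFactor_sup (h : IsIsotropic (L ⊔ K)) (ho : L ⟂ K) (α : ℂ) :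
    LoopEq (simpleFactor α (L ⊔ K)) fun z => simpleFactor α L z * simpleFactor α K z :=
  loopEq_of_eqOn_compl_pair α (conj α) fun _ hz => simpleFactor_sup h ho hz

lemma loopEq_simpleFactor_sup_mul_simpleFactor_sup (hLR : L ⟂ R) (hRK : conjSub R ⟂ K)
    (h₁ : IsIsotropic (L ⊔ R)) (h₂ : IsIsotropic (conjSub R ⊔ K)) (α : ℂ) :
    LoopEq (fun z => simpleFactor α L z * simpleFactor α K z)
      fun z => simpleFactor α (L ⊔ R) z * simpleFactor α (conjSub R ⊔ K) z := by
  have hR : IsIsotropic R := fun x hx y hy =>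
    h₁ x (Submodule.mem_sup_right hx) y (Submodule.mem_sup_right hy)
  refine loopEq_of_eqOn_compl_pair α (conj α) fun z hz => ?_
  simp only [simpleFactor_sup h₁ hLR hz, simpleFactor_sup h₂ hRK hz]
  rw [mul_assoc, ← mul_assoc (simpleFactor α R z), simpleFactor_mul_simpleFactor_conjSub hR hz,
    one_mul]

end CoassociativePlanes

end G2Loop

theorem mainTheorem7 (α : ℂ) (hα : α.im ≠ 0) :
    (∀ L K : Submodule ℂ G2Loop.V, G2Loop.IsIsotropicLine L → G2Loop.IsIsotropicLine K →
      K ≠ G2Loop.conjSub L →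
      (G2Loop.PairCondition L K ↔
        G2Loop.IsNegRealG2Loop
          (fun z => G2Loop.simpleFactor α L z * G2Loop.simpleFactor α K z))) ∧
    (∀ L K : Submodule ℂ G2Loop.V, G2Loop.IsIsotropicLine L → G2Loop.IsIsotropicLine K →
      G2Loop.PairCondition L K →
      G2Loop.OnlySimplePoles
        (fun z => G2Loop.simpleFactor α L z * G2Loop.simpleFactor α K z) α) ∧
    (∀ g : ℂ → G2Loop.V →L[ℂ] G2Loop.V,
      G2Loop.IsNegRealG2Loop g → G2Loop.OnlySimplePoles g α →
      (∃ L K : Submodule ℂ G2Loop.V, G2Loop.IsIsotropicLine L ∧ G2Loop.IsIsotropicLine K ∧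
        G2Loop.PairCondition L K ∧
        G2Loop.LoopEq g
          (fun z => G2Loop.simpleFactor α L z * G2Loop.simpleFactor α K z)) ∧
      (∀ L K : Submodule ℂ G2Loop.V, G2Loop.IsIsotropicLine L → G2Loop.IsIsotropicLine K →
        G2Loop.LoopEq g
          (fun z => G2Loop.simpleFactor α L z * G2Loop.simpleFactor α K z) →
        (K ≤ G2Loop.perp (L ⊔ G2Loop.conjSub L) →
          G2Loop.pairPlane L K = L ⊔ K ∧ G2Loop.IsCoassociative (L ⊔ K) ∧
          G2Loop.LoopEq g (G2Loop.simpleFactor α (L ⊔ K))) ∧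
        (¬ K ≤ G2Loop.perp (L ⊔ G2Loop.conjSub L) →
          ∃ R : Submodule ℂ G2Loop.V, G2Loop.IsIsotropicLine R ∧
            G2Loop.IsCoassociative (L ⊔ R) ∧
            G2Loop.IsCoassociative (G2Loop.conjSub R ⊔ K) ∧
            G2Loop.LoopEq g
              (fun z => G2Loop.simpleFactor α (L ⊔ R) z *
                G2Loop.simpleFactor α (G2Loop.conjSub R ⊔ K) z)))) := by
  refine ⟨fun L K hL hK hne => ⟨fun h => h.isNegRealG2Loop hL hK α, fun h => ?_⟩,
    fun L K hL hK h => h.onlySimplePoles hL hK hα, fun g hg hpole => ⟨?_, fun L K hL hK h => ?_⟩⟩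
  · exact G2Loop.pairCondition_of_isRationalG2Loop hα hL hK hne h.toIsRationalG2Loop
      (G2Loop.LoopEq.refl _)
  · obtain ⟨L, K, hL, hK, h⟩ := hg.exists_loopEq_simpleFactor_mul_simpleFactor hα hpole
    exact ⟨L, K, hL, hK, hg.pairCondition_of_loopEq hα hpole hL hK h, h⟩
  have hLK := hg.pairCondition_of_loopEq hα hpole hL hK h
  refine ⟨fun hperp => ?_, fun _ => ?_⟩
  · have hplane := G2Loop.pairPlane_eq_sup hperp
    have hcoass : G2Loop.IsCoassociative (L ⊔ K) := hplane ▸ hLK.2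
    exact ⟨hplane, hcoass, h.trans <| G2Loop.LoopEq.symm <|
      G2Loop.loopEq_simpleFactor_sup hcoass.2.1 (G2Loop.isOrtho_of_le_perp hperp) α⟩
  · obtain ⟨R, hR, hLR, hRK, h₁, h₂⟩ := hLK.exists_completing_line hL hK
    exact ⟨R, hR, h₁, h₂, h.trans <|
      G2Loop.loopEq_simpleFactor_sup_mul_simpleFactor_sup hLR hRK h₁.2.1 h₂.2.1 α⟩
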